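/- Let $p > 3$ be a prime and let $E$ be a supersingular elliptic curve over an algebraic closure $\overline{\mathbb F}_p$ of $\mathbb F_p$, i.e. $E$ has no point of order $p$ over $\overline{\mathbb F}_p$. Say that $E$ is defined over $\mathbb F_p$ if $E$ is isomorphic over $\overline{\mathbb F}_p$ to an elliptic curve given by a Weierstrass equation with coefficients in $\mathbb F_p$, and let $\operatorname{End} E$ be the ring of all endomorphisms of $E$ over $\overline{\mathbb F}_p$ (morphisms of curves that are group homomorphisms, with pointwise addition and composition). Then $$E \text{ is defined over } \mathbb F_p \iff \mathbb Z[\sqrt{-p}] \subseteq \operatorname{End} E,$$ where the right-hand side means that there is an injective ring homomorphism $\mathbb Z[\sqrt{-p}] \to \operatorname{End} E$. -/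

import Mathlib

namespace EllCurve

open MvPolynomial

section Morphisms

variable {K : Type*} [Field K]

/-- Homogeneous coordinates `(X, Y, Z)` of a point of a Weierstrass curve: `(0, 1, 0)` for the point
at infinity and `(x, y, 1)` for an affine point `(x, y)`. -/
def coords {E : WeierstrassCurve K} : E.toAffine.Point → Fin 3 → K
  | .zero => ![0, 1, 0]
  | .some x y _ => ![x, y, 1]

/-- A map from the points of `E` to the points of `E'` is regular at `P` if there are three
homogeneous polynomials of the same degree, not all vanishing at `P`, such that for every point `Q`
at which they do not all vanish, their values at `Q` are homogeneous coordinates of `φ Q`.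
(In the last clause `c = 0` means exactly that all three vanish at `Q`.) -/
def IsRegularAt {E E' : WeierstrassCurve K} (φ : E.toAffine.Point → E'.toAffine.Point)
    (P : E.toAffine.Point) : Prop :=
  ∃ (d : ℕ) (F : Fin 3 → MvPolynomial (Fin 3) K), (∀ i, (F i).IsHomogeneous d) ∧
    (∃ i, eval (coords P) (F i) ≠ 0) ∧
    ∀ Q, ∃ c : K, (fun i => eval (coords Q) (F i)) = c • coords (φ Q)

/-- A morphism of projective curves, given on points over the algebraically closed base field. -/
def IsMorphism {E E' : WeierstrassCurve K} (φ : E.toAffine.Point → E'.toAffine.Point) : Prop :=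
  ∀ P, IsRegularAt φ P

variable {E : WeierstrassCurve K}

theorem coords_ne_zero (P : E.toAffine.Point) : ∃ i, coords P i ≠ 0 := by
  cases P with
  | zero => exact ⟨1, by simp [coords]⟩
  | some x y h => exact ⟨2, by simp [coords]⟩

theorem coords_equation (P : E.toAffine.Point) : E.toProjective.Equation (coords P) := by
  cases P with
  | zero => exact WeierstrassCurve.Projective.equation_zero
  | some x y h => exact (WeierstrassCurve.Projective.equation_some x y).mpr h.1

theorem isRegularAt_const {E' : WeierstrassCurve K} (T : E'.toAffine.Point)
    (P : E.toAffine.Point) : IsRegularAt (fun _ => T) P := by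
  refine ⟨0, fun i => C (coords T i), fun i => isHomogeneous_C _ _, ?_, fun Q => ⟨1, ?_⟩⟩
  · simpa using coords_ne_zero T
  · simp

theorem isRegularAt_id (P : E.toAffine.Point) : IsRegularAt (fun Q => Q) P := by
  refine ⟨1, fun i => X i, fun i => isHomogeneous_X _ _, ?_, fun Q => ⟨1, ?_⟩⟩
  · simpa using coords_ne_zero P
  · simp

theorem IsRegularAt.ne_zero {E E' : WeierstrassCurve K} {c : K} {Q : E.toAffine.Point}
    {F : Fin 3 → MvPolynomial (Fin 3) K} {R : E'.toAffine.Point}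
    (h : ∃ i, eval (coords Q) (F i) ≠ 0)
    (hc : (fun i => eval (coords Q) (F i)) = c • coords R) : c ≠ 0 := by
  rintro rfl
  obtain ⟨i, hi⟩ := h
  exact hi (by simpa using congrFun hc i)

theorem eval_smul_of_homogeneous {f : MvPolynomial (Fin 3) K} {d : ℕ} (hf : f.IsHomogeneous d)
    (c : K) (v : Fin 3 → K) : eval (c • v) f = c ^ d * eval v f := by
  rw [eval_eq, eval_eq, Finset.mul_sum]
  refine Finset.sum_congr rfl fun m hm => ?_
  have hd := hf.degree_eq_sum_deg_support hm
  simp only [Pi.smul_apply, smul_eq_mul, mul_pow, Finset.prod_mul_distrib, Finset.prod_pow_eq_pow_sum]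
  rw [← hd]
  ring

theorem IsRegularAt.comp {E₁ E₂ E₃ : WeierstrassCurve K}
    {ψ : E₂.toAffine.Point → E₃.toAffine.Point} {φ : E₁.toAffine.Point → E₂.toAffine.Point}
    {P : E₁.toAffine.Point} (hψ : IsRegularAt ψ (φ P)) (hφ : IsRegularAt φ P) :
    IsRegularAt (fun Q => ψ (φ Q)) P := by
  obtain ⟨d, F, hF, hFP, hFQ⟩ := hφ
  obtain ⟨e, G, hG, hGP, hGQ⟩ := hψ
  have key : ∀ (Q : E₁.toAffine.Point) (c : K),
      (fun i => eval (coords Q) (F i)) = c • coords (φ Q) → ∀ i,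
      eval (coords Q) (aeval F (G i)) = c ^ e * eval (coords (φ Q)) (G i) := by
    intro Q c hc i
    rw [← eval_smul_of_homogeneous (hG i), ← hc]
    induction G i using MvPolynomial.induction_on with
    | C a => simp
    | add p q hp hq => simp only [map_add, hp, hq]
    | mul_X p n hp => simp only [map_mul, hp, aeval_X, eval_X]
  refine ⟨d * e, fun i => aeval F (G i), fun i => (hG i).aeval F hF, ?_, fun Q => ?_⟩
  · obtain ⟨c, hc⟩ := hFQ P
    obtain ⟨i, hi⟩ := hGP
    exact ⟨i, by rw [key P c hc i]; exact mul_ne_zero (pow_ne_zero _ (ne_zero hFP hc)) hi⟩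
  · obtain ⟨c, hc⟩ := hFQ Q
    obtain ⟨c', hc'⟩ := hGQ (φ Q)
    refine ⟨c ^ e * c', funext fun i => ?_⟩
    rw [key Q c hc i, congrFun hc' i]
    simp [mul_assoc]

end Morphisms

section Addition

variable {K : Type*} [Field K] {E : WeierstrassCurve K}

theorem exists_addXYZ_eq [DecidableEq K] (P Q : E.toAffine.Point) :
    ∃ c : K, E.toProjective.addXYZ (coords P) (coords Q) = c • coords (P + Q) ∧
      (P ≠ Q → c ≠ 0) := by
  have hP := coords_equation P
  have hQ := coords_equation Q
  by_cases hPQ : P = Q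
  · subst hPQ
    refine ⟨0, ?_, fun h => (h rfl).elim⟩
    rw [WeierstrassCurve.Projective.addXYZ_self]
    ext i; fin_cases i <;> simp
  rcases P with _ | ⟨x₁, y₁, h₁⟩
  · rw [WeierstrassCurve.Projective.addXYZ_of_Z_eq_zero_left hP (by simp [coords]),
      ← WeierstrassCurve.Affine.Point.zero_def, zero_add]
    refine ⟨_, rfl, fun _ => ?_⟩
    rcases Q with _ | ⟨x₂, y₂, h₂⟩
    · exact (hPQ rfl).elim
    · simp [coords]
  rcases Q with _ | ⟨x₂, y₂, h₂⟩
  · rw [WeierstrassCurve.Projective.addXYZ_of_Z_eq_zero_right hQ (by simp [coords]),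
      ← WeierstrassCurve.Affine.Point.zero_def, add_zero]
    refine ⟨_, rfl, fun _ => ?_⟩
    simp [coords]
  by_cases hx : x₁ = x₂
  · have hy : y₁ ≠ y₂ := fun hy => hPQ (by subst hx hy; rfl)
    have hy' : y₁ = E.toAffine.negY x₂ y₂ :=
      (WeierstrassCurve.Affine.Y_eq_of_X_eq h₁.1 h₂.1 hx).resolve_left hy
    rw [WeierstrassCurve.Projective.addXYZ_of_X_eq hP hQ (by simp [coords]) (by simp [coords])
      (by simp [coords, hx]), WeierstrassCurve.Affine.Point.add_of_Y_eq hx hy']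
    exact ⟨_, rfl, fun _ => WeierstrassCurve.Projective.addU_ne_zero_of_Y_ne (by simp [coords])
      (by simp [coords]) (by simpa [coords] using hy)⟩
  · have hx' : coords (.some x₁ y₁ h₁ : E.toAffine.Point) 0 *
        coords (.some x₂ y₂ h₂ : E.toAffine.Point) 2 ≠
        coords (.some x₂ y₂ h₂ : E.toAffine.Point) 0 *
        coords (.some x₁ y₁ h₁ : E.toAffine.Point) 2 := by simpa [coords] using hx
    rw [WeierstrassCurve.Projective.addXYZ_of_Z_ne_zero hP hQ (by simp [coords]) (by simp [coords])
      hx', WeierstrassCurve.Affine.Point.add_some (fun h => hx h.1)]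
    refine ⟨_, ?_, fun _ => WeierstrassCurve.Projective.addZ_ne_zero_of_X_ne hP hQ hx'⟩
    simp [coords]

theorem of_eq_degree {f : MvPolynomial (Fin 3) K} {m n : ℕ} (hf : f.IsHomogeneous m) (h : m = n) :
    f.IsHomogeneous n := h ▸ hf

theorem addXYZ_isHomogeneous {F G : Fin 3 → MvPolynomial (Fin 3) K} {d e : ℕ}
    (hF : ∀ i, (F i).IsHomogeneous d) (hG : ∀ i, (G i).IsHomogeneous e) (i : Fin 3) :
    ((E.map C).toProjective.addXYZ F G i).IsHomogeneous (2 * d + 2 * e) := by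
  have hc : ∀ a : K, (C a : MvPolynomial (Fin 3) K).IsHomogeneous 0 := isHomogeneous_C _
  have h2 : (2 : MvPolynomial (Fin 3) K).IsHomogeneous 0 := by
    rw [← map_ofNat (C : K →+* MvPolynomial (Fin 3) K) 2]; exact hc _
  have h3 : (3 : MvPolynomial (Fin 3) K).IsHomogeneous 0 := by
    rw [← map_ofNat (C : K →+* MvPolynomial (Fin 3) K) 3]; exact hc _
  have hadd : ∀ {f g : MvPolynomial (Fin 3) K} {n : ℕ}, f.IsHomogeneous n → g.IsHomogeneous n →
      (f + g).IsHomogeneous n := fun hf hg => hf.add hg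
  have hsub : ∀ {f g : MvPolynomial (Fin 3) K} {n : ℕ}, f.IsHomogeneous n → g.IsHomogeneous n →
      (f - g).IsHomogeneous n := fun hf hg => hf.sub hg
  have hX : ((E.map C).toProjective.addX F G).IsHomogeneous (2 * d + 2 * e) := by
    simp only [WeierstrassCurve.Projective.addX, WeierstrassCurve.map_a₁, WeierstrassCurve.map_a₂,
      WeierstrassCurve.map_a₃, WeierstrassCurve.map_a₄, WeierstrassCurve.map_a₆]
    repeat' first | with_reducible apply hadd | with_reducible apply hsub
    all_goals
      apply of_eq_degree
      · repeat' first
          | with_reducible exact hF _ | with_reducible exact hG _ | with_reducible exact (hF _).neg | with_reducible exact hc _ | with_reducible exact h2 | with_reducible exact h3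
          | with_reducible exact h3.neg | with_reducible apply IsHomogeneous.mul | with_reducible apply IsHomogeneous.pow
      · omega
  have hZ : ((E.map C).toProjective.addZ F G).IsHomogeneous (2 * d + 2 * e) := by
    simp only [WeierstrassCurve.Projective.addZ, WeierstrassCurve.map_a₁, WeierstrassCurve.map_a₂,
      WeierstrassCurve.map_a₃, WeierstrassCurve.map_a₄]
    repeat' first | with_reducible apply hadd | with_reducible apply hsub
    all_goals
      apply of_eq_degree
      · repeat' first
          | with_reducible exact hF _ | with_reducible exact hG _ | with_reducible exact (hF _).neg | with_reducible exact hc _ | with_reducible exact h2 | with_reducible exact h3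
          | with_reducible exact h3.neg | with_reducible apply IsHomogeneous.mul | with_reducible apply IsHomogeneous.pow
      · omega
  have hN : ((E.map C).toProjective.negAddY F G).IsHomogeneous (2 * d + 2 * e) := by
    simp only [WeierstrassCurve.Projective.negAddY, WeierstrassCurve.map_a₁,
      WeierstrassCurve.map_a₂, WeierstrassCurve.map_a₃, WeierstrassCurve.map_a₄,
      WeierstrassCurve.map_a₆]
    repeat' first | with_reducible apply hadd | with_reducible apply hsub
    all_goals
      apply of_eq_degree
      · repeat' first
          | with_reducible exact hF _ | with_reducible exact hG _ | with_reducible exact (hF _).neg | with_reducible exact hc _ | with_reducible exact h2 | with_reducible exact h3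
          | with_reducible exact h3.neg | with_reducible apply IsHomogeneous.mul | with_reducible apply IsHomogeneous.pow
      · omega
  have hY : ((E.map C).toProjective.addY F G).IsHomogeneous (2 * d + 2 * e) := by
    rw [WeierstrassCurve.Projective.addY, WeierstrassCurve.Projective.negY_eq]
    have h1 := (hc E.a₁).mul hX
    have h3 := (hc E.a₃).mul hZ
    rw [zero_add] at h1 h3
    exact (hN.neg.sub h1).sub h3
  fin_cases i
  · exact hX
  · exact hY
  · exact hZ

/-- The sum of two maps is regular at a point where their values differ. -/
theorem IsRegularAt.add_of_ne [DecidableEq K] {E' : WeierstrassCurve K}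
    {φ ψ : E'.toAffine.Point → E.toAffine.Point} {P : E'.toAffine.Point}
    (hφ : IsRegularAt φ P) (hψ : IsRegularAt ψ P) (hne : φ P ≠ ψ P) :
    IsRegularAt (fun Q => φ Q + ψ Q) P := by
  obtain ⟨d, F, hF, hFP, hFQ⟩ := hφ
  obtain ⟨e, G, hG, hGP, hGQ⟩ := hψ
  have key : ∀ (Q : E'.toAffine.Point) (a b : K),
      (fun i => eval (coords Q) (F i)) = a • coords (φ Q) →
      (fun i => eval (coords Q) (G i)) = b • coords (ψ Q) →
      (fun i => eval (coords Q) ((E.map C).toProjective.addXYZ F G i)) =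
        (a * b) ^ 2 • E.toProjective.addXYZ (coords (φ Q)) (coords (ψ Q)) := by
    intro Q a b ha hb
    rw [← WeierstrassCurve.Projective.addXYZ_smul, ← ha, ← hb]
    have := WeierstrassCurve.Projective.map_addXYZ (W' := (E.map C).toProjective)
      (eval (coords Q)) F G
    have hE : (E.map C).map (eval (coords Q)) = E := by
      rw [WeierstrassCurve.map_map]
      convert E.map_id
      ext; simp
    have h2 : ((E.map C).toProjective.map (eval (coords Q))) = E.toProjective := hE
    rw [h2] at this
    exact this.symm
  refine ⟨_, _, addXYZ_isHomogeneous (E := E) hF hG, ?_, fun Q => ?_⟩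
  · obtain ⟨a, ha⟩ := hFQ P
    obtain ⟨b, hb⟩ := hGQ P
    obtain ⟨c, hc, hc'⟩ := exists_addXYZ_eq (φ P) (ψ P)
    obtain ⟨i, hi⟩ := coords_ne_zero (φ P + ψ P)
    refine ⟨i, ?_⟩
    rw [congrFun (key P a b ha hb) i, hc]
    simp only [Pi.smul_apply, smul_eq_mul]
    exact mul_ne_zero (pow_ne_zero _ (mul_ne_zero (ne_zero hFP ha) (ne_zero hGP hb)))
      (mul_ne_zero (hc' hne) hi)
  · obtain ⟨a, ha⟩ := hFQ Q
    obtain ⟨b, hb⟩ := hGQ Q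
    obtain ⟨c, hc, -⟩ := exists_addXYZ_eq (φ Q) (ψ Q)
    exact ⟨(a * b) ^ 2 * c, by rw [key Q a b ha hb, hc, smul_smul]⟩

theorem isRegularAt_neg (P : E.toAffine.Point) : IsRegularAt (fun Q => -Q) P := by
  have key : ∀ Q : E.toAffine.Point, ∃ c : K, c ≠ 0 ∧ (fun i => eval (coords Q)
      ((![X 0, -X 1 - C E.a₁ * X 0 - C E.a₃ * X 2, X 2] : Fin 3 → MvPolynomial (Fin 3) K) i)) =
        c • coords (-Q) := by
    rintro (_ | ⟨x, y, h⟩)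
    · refine ⟨-1, by simp, ?_⟩
      ext i
      rw [← WeierstrassCurve.Affine.Point.zero_def, WeierstrassCurve.Affine.Point.neg_zero]
      fin_cases i <;> simp [coords]
    · refine ⟨1, by simp, ?_⟩
      ext i
      rw [WeierstrassCurve.Affine.Point.neg_some]
      fin_cases i <;> simp [coords, WeierstrassCurve.Affine.negY]
  refine ⟨1, _, fun i => ?_, ?_, fun Q => (key Q).imp fun c hc => hc.2⟩
  · have hX : ∀ (a : K) (j : Fin 3), (C a * X j : MvPolynomial (Fin 3) K).IsHomogeneous 1 :=
      fun a j => by simpa using (isHomogeneous_C (Fin 3) a).mul (isHomogeneous_X K j)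
    fin_cases i
    · exact isHomogeneous_X _ _
    · exact ((isHomogeneous_X _ _).neg.sub (hX _ _)).sub (hX _ _)
    · exact isHomogeneous_X _ _
  · obtain ⟨c, hc, h⟩ := key P
    obtain ⟨i, hi⟩ := coords_ne_zero (-P)
    exact ⟨i, by rw [congrFun h i]; exact mul_ne_zero hc hi⟩

variable [IsAlgClosed K] [E.IsElliptic]

/-- A non-2-torsion point distinct from a given point and its negative. -/
theorem exists_aux_point (A : E.toAffine.Point) :
    ∃ T : E.toAffine.Point, T ≠ -T ∧ T ≠ A ∧ T ≠ -A := by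
  classical
  set f : Polynomial K := E.twoTorsionPolynomial.toPoly with hf
  have hf0 : f ≠ 0 := by
    intro h
    have hC : E.twoTorsionPolynomial = 0 := Cubic.toPoly_eq_zero_iff _ |>.mp h
    have h2 : E.b₂ = 0 := congrArg Cubic.b hC
    have h4 : 2 * E.b₄ = 0 := congrArg Cubic.c hC
    have h6 : E.b₆ = 0 := congrArg Cubic.d hC
    refine (E.coe_Δ' ▸ E.Δ'.ne_zero : E.Δ ≠ 0) ?_
    rw [WeierstrassCurve.Δ, h2, h6]
    linear_combination (-4 * E.b₄ ^ 2) * h4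
  obtain ⟨x, hx⟩ : ∃ x, x ∉ insert (coords A 0) (f.roots.toFinset : Set K) :=
    (Set.Finite.insert _ (Finset.finite_toSet _)).infinite_compl.nonempty
  rw [Set.mem_insert_iff, not_or] at hx
  obtain ⟨hxA, hxf⟩ := hx
  have hxf' : f.eval x ≠ 0 := fun h => hxf (by simpa [hf0] using h)
  obtain ⟨y, hy⟩ : ∃ y, E.toAffine.Equation x y := by
    obtain ⟨y, hy⟩ := IsAlgClosed.exists_root
      (E.toAffine.polynomial.map (Polynomial.evalRingHom x)) (by
        rw [WeierstrassCurve.Affine.monic_polynomial.degree_map,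
          WeierstrassCurve.Affine.degree_polynomial]
        decide)
    refine ⟨y, ?_⟩
    rw [WeierstrassCurve.Affine.Equation, ← Polynomial.map_evalRingHom_eval]
    exact hy
  have hns : E.toAffine.Nonsingular x y := WeierstrassCurve.Affine.equation_iff_nonsingular.mp hy
  refine ⟨.some x y hns, fun h => hxf' ?_, fun h => hxA ?_, fun h => hxA ?_⟩
  · rw [WeierstrassCurve.Affine.Point.neg_some, WeierstrassCurve.Affine.Point.some.injEq,
      WeierstrassCurve.Affine.negY] at h
    rw [WeierstrassCurve.Affine.equation_iff] at hy
    simp only [hf, WeierstrassCurve.twoTorsionPolynomial, Cubic.toPoly, Polynomial.eval_add,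
      Polynomial.eval_mul, Polynomial.eval_pow, Polynomial.eval_C, Polynomial.eval_X,
      WeierstrassCurve.b₂, WeierstrassCurve.b₄, WeierstrassCurve.b₆]
    linear_combination (2 * y + E.a₁ * x + E.a₃) * h.2 - 4 * hy
  · rw [← h]
    simp [coords]
  · rw [← neg_neg A, ← h, WeierstrassCurve.Affine.Point.neg_some]
    simp [coords]

theorem IsRegularAt.add [DecidableEq K] {E' : WeierstrassCurve K}
    {φ ψ : E'.toAffine.Point → E.toAffine.Point} {P : E'.toAffine.Point}
    (hφ : IsRegularAt φ P) (hψ : IsRegularAt ψ P) :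
    IsRegularAt (fun Q => φ Q + ψ Q) P := by
  by_cases hne : φ P = ψ P
  · obtain ⟨T, h1, h2, h3⟩ := exists_aux_point (φ P)
    have ha := hφ.add_of_ne (isRegularAt_const T P) (Ne.symm h2)
    have hb := hψ.add_of_ne (isRegularAt_const (-T) P)
      (fun h => h3 (by rw [hne, h, neg_neg]))
    have hc := ha.add_of_ne hb (fun h => h1 (by rw [hne] at h; exact add_left_cancel h))
    have he : (fun Q => φ Q + T + (ψ Q + -T)) = fun Q => φ Q + ψ Q := funext fun Q => by abel
    rwa [he] at hc
  · exact hφ.add_of_ne hψ hne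

end Addition

section Main

variable {K : Type*} [Field K]

/-- The endomorphism ring of an elliptic curve over an algebraically closed field `K`: the group
endomorphisms of the curve that are morphisms of curves, with pointwise addition and with
composition as multiplication. -/
def endRing [DecidableEq K] [IsAlgClosed K] (E : WeierstrassCurve K) [E.IsElliptic] :
    Subring (AddMonoid.End E.toAffine.Point) where
  carrier := {φ | IsMorphism φ}
  mul_mem' {_ _} hφ hψ P := (hφ _).comp (hψ P)
  one_mem' P := isRegularAt_id P
  add_mem' {_ _} hφ hψ P := (hφ P).add (hψ P)
  zero_mem' P := isRegularAt_const 0 P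
  neg_mem' {_} hφ P := (isRegularAt_neg _).comp (hφ P)

/-- A curve over a field of characteristic `p` is supersingular if it has no point of order `p`
(to be used over an algebraically closed field). -/
def IsSupersingular [DecidableEq K] (p : ℕ) (E : WeierstrassCurve K) : Prop :=
  ∀ P : E.toAffine.Point, p • P = 0 → P = 0

/-- `E` is defined over the subfield `k` if it is isomorphic over `K` to an elliptic curve given by a
Weierstrass equation with coefficients in `k`. -/
def IsDefinedOver (k : Type*) [Field k] [Algebra k K] (E : WeierstrassCurve K) : Prop :=
  ∃ (E₀ : WeierstrassCurve k) (u : WeierstrassCurve.VariableChange K),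
    E₀.IsElliptic ∧ u • E₀.baseChange K = E

end Main

end EllCurve

/-!
An endomorphism commutes with negation, so it acts on `x`-coordinates by a self-map of `ℙ¹`, whose
degree is a multiplicative, positive definite quadratic norm on `End E`. In particular every
endomorphism `π` satisfies `π² - aπ + deg π = 0` for some integer `a`.

If `φ` is injective and `deg φ = q` is a power of `p`, the induced map has no finite pole and is
injective, so it is `x ↦ cx^q + d`; as it permutes the `x`-coordinates of the points of order two,
`x ↦ cx + d` comes from an isomorphism from the `q`-Frobenius twist of `E` to `E`. On a
supersingular curve this applies to `[p]`, of degree `p²`, and to any `α` with `α² = -p`, of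
degree `p`.

* If `E` is defined over `𝔽_p`, it yields `[p] = ρπ²` with `π` the Frobenius and `ρ` an
  automorphism. Then `(1 + ρ)π = a`, so `deg (1 + ρ) ≤ 4` is `p` times a square; this forces
  `ρ = -1` as `p > 3`, that is, `π² = -p`.
* If `α² = -p`, then `E` is isomorphic to its `p`-Frobenius twist, so `j(E)^p = j(E)`, which means
  that `j(E)` lies in `𝔽_p`.
-/

namespace EllCurve

open WeierstrassCurve

section Morphisms

variable {K : Type*} [Field K] {E E' : WeierstrassCurve K}

theorem coords_zero : coords (0 : E.toAffine.Point) = ![0, 1, 0] := rfl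

theorem coords_some {x y : K} (h : E.toAffine.Nonsingular x y) :
    coords (.some x y h) = ![x, y, 1] := rfl

theorem IsMorphism.of_forall_eval_eq_smul {φ : E.toAffine.Point → E'.toAffine.Point} {d : ℕ}
    {F : Fin 3 → MvPolynomial (Fin 3) K} (hF : ∀ i, (F i).IsHomogeneous d)
    (h : ∀ Q, ∃ c : K, c ≠ 0 ∧ (fun i => MvPolynomial.eval (coords Q) (F i)) = c • coords (φ Q)) :
    IsMorphism φ := by
  refine fun P => ⟨d, F, hF, ?_, fun Q => (h Q).imp fun c hc => hc.2⟩
  obtain ⟨c, hc, hP⟩ := h P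
  obtain ⟨i, hi⟩ := coords_ne_zero (φ P)
  exact ⟨i, by rw [congrFun hP i]; exact mul_ne_zero hc hi⟩

end Morphisms

section VariableChange

variable {K : Type*} [Field K] {E E' : WeierstrassCurve K} {C : VariableChange K}

theorem variableChange_equation (h : C • E = E') {x y : K} (hxy : E'.toAffine.Equation x y) :
    E.toAffine.Equation (C.u ^ 2 * x + C.r) (C.u ^ 3 * y + C.u ^ 2 * C.s * x + C.t) := by
  subst h
  rw [Affine.equation_iff] at hxy ⊢
  simp only [variableChange_a₁, variableChange_a₂, variableChange_a₃, variableChange_a₄,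
    variableChange_a₆, Units.val_inv_eq_inv_val] at hxy
  field_simp at hxy
  linear_combination hxy

theorem variableChange_X_eq_iff (C : VariableChange K) {x₁ x₂ : K} :
    C.u ^ 2 * x₁ + C.r = C.u ^ 2 * x₂ + C.r ↔ x₁ = x₂ := by
  simp

theorem variableChange_negY (h : C • E = E') (x y : K) :
    E.toAffine.negY (C.u ^ 2 * x + C.r) (C.u ^ 3 * y + C.u ^ 2 * C.s * x + C.t) =
      C.u ^ 3 * E'.toAffine.negY x y + C.u ^ 2 * C.s * x + C.t := by
  subst h
  simp only [Affine.negY, variableChange_a₁, variableChange_a₃, Units.val_inv_eq_inv_val]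
  field_simp
  ring

theorem variableChange_Y_eq_negY_iff (h : C • E = E') {x y₁ y₂ : K} :
    C.u ^ 3 * y₁ + C.u ^ 2 * C.s * x + C.t =
        E.toAffine.negY (C.u ^ 2 * x + C.r) (C.u ^ 3 * y₂ + C.u ^ 2 * C.s * x + C.t) ↔
      y₁ = E'.toAffine.negY x y₂ := by
  rw [variableChange_negY h]
  simp

theorem variableChange_addX (h : C • E = E') (x₁ x₂ ℓ : K) :
    E.toAffine.addX (C.u ^ 2 * x₁ + C.r) (C.u ^ 2 * x₂ + C.r) (C.u * ℓ + C.s) =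
      C.u ^ 2 * E'.toAffine.addX x₁ x₂ ℓ + C.r := by
  subst h
  simp only [Affine.addX, variableChange_a₁, variableChange_a₂, Units.val_inv_eq_inv_val]
  field_simp
  ring

theorem variableChange_addY (h : C • E = E') (x₁ x₂ y₁ ℓ : K) :
    E.toAffine.addY (C.u ^ 2 * x₁ + C.r) (C.u ^ 2 * x₂ + C.r)
        (C.u ^ 3 * y₁ + C.u ^ 2 * C.s * x₁ + C.t) (C.u * ℓ + C.s) =
      C.u ^ 3 * E'.toAffine.addY x₁ x₂ y₁ ℓ + C.u ^ 2 * C.s * E'.toAffine.addX x₁ x₂ ℓ + C.t := by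
  rw [Affine.addY, Affine.addY, Affine.negAddY, Affine.negAddY, variableChange_addX h,
    ← variableChange_negY h]
  congr 1
  ring

variable [DecidableEq K]

theorem variableChange_slope_of_X_ne {x₁ x₂ y₁ y₂ : K} (hx : x₁ ≠ x₂) :
    E.toAffine.slope (C.u ^ 2 * x₁ + C.r) (C.u ^ 2 * x₂ + C.r)
        (C.u ^ 3 * y₁ + C.u ^ 2 * C.s * x₁ + C.t) (C.u ^ 3 * y₂ + C.u ^ 2 * C.s * x₂ + C.t) =
      C.u * E'.toAffine.slope x₁ x₂ y₁ y₂ + C.s := by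
  rw [Affine.slope_of_X_ne hx, Affine.slope_of_X_ne ((variableChange_X_eq_iff C).not.mpr hx),
    add_sub_add_right_eq_sub _ _ C.r, ← mul_sub]
  have hx' : x₁ - x₂ ≠ 0 := sub_ne_zero.mpr hx
  field_simp
  ring

theorem variableChange_slope_self (h : C • E = E') {x y : K} (hy : y ≠ E'.toAffine.negY x y) :
    E.toAffine.slope (C.u ^ 2 * x + C.r) (C.u ^ 2 * x + C.r)
        (C.u ^ 3 * y + C.u ^ 2 * C.s * x + C.t) (C.u ^ 3 * y + C.u ^ 2 * C.s * x + C.t) =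
      C.u * E'.toAffine.slope x x y y + C.s := by
  rw [Affine.slope_of_Y_ne rfl hy,
    Affine.slope_of_Y_ne rfl ((variableChange_Y_eq_negY_iff h).not.mpr hy), variableChange_negY h,
    add_sub_add_right_eq_sub, add_sub_add_right_eq_sub, ← mul_sub]
  have hy' : y - E'.toAffine.negY x y ≠ 0 := sub_ne_zero.mpr hy
  field_simp
  subst h
  simp only [Affine.negY, variableChange_a₁, variableChange_a₂, variableChange_a₃,
    variableChange_a₄, Units.val_inv_eq_inv_val]
  field_simp
  ring

theorem variableChange_slope (h : C • E = E') {x₁ x₂ y₁ y₂ : K}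
    (hxy : ¬(x₁ = x₂ ∧ y₁ = E'.toAffine.negY x₂ y₂))
    (h₁ : E'.toAffine.Equation x₁ y₁) (h₂ : E'.toAffine.Equation x₂ y₂) :
    E.toAffine.slope (C.u ^ 2 * x₁ + C.r) (C.u ^ 2 * x₂ + C.r)
        (C.u ^ 3 * y₁ + C.u ^ 2 * C.s * x₁ + C.t) (C.u ^ 3 * y₂ + C.u ^ 2 * C.s * x₂ + C.t) =
      C.u * E'.toAffine.slope x₁ x₂ y₁ y₂ + C.s := by
  by_cases hx : x₁ = x₂
  · subst hx
    have hy : y₁ ≠ E'.toAffine.negY x₁ y₂ := fun hy => hxy ⟨rfl, hy⟩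
    obtain rfl : y₁ = y₂ := Affine.Y_eq_of_Y_ne h₁ h₂ rfl hy
    exact variableChange_slope_self h hy
  · exact variableChange_slope_of_X_ne hx

variable [E.IsElliptic]

/-- The substitution `(x, y) ↦ (u²x + r, u³y + u²sx + t)`, as a map from the points of `C • E` to
the points of `E`. The curve `C • E` is given up to an equation so that `C` and `C⁻¹` can be treated
alike. -/
def variableChangeFun (h : C • E = E') : E'.toAffine.Point → E.toAffine.Point
  | .zero => 0
  | .some _ _ hxy => .some _ _
      (Affine.equation_iff_nonsingular.mp (variableChange_equation h hxy.1))

theorem variableChangeFun_add (h : C • E = E') (P Q : E'.toAffine.Point) :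
    variableChangeFun h (P + Q) = variableChangeFun h P + variableChangeFun h Q := by
  rcases P with _ | ⟨x₁, y₁, h₁⟩
  · rfl
  rcases Q with _ | ⟨x₂, y₂, h₂⟩
  · rfl
  by_cases hxy : x₁ = x₂ ∧ y₁ = E'.toAffine.negY x₂ y₂
  · obtain ⟨rfl, hy⟩ := hxy
    rw [Affine.Point.add_of_Y_eq rfl hy]
    exact (Affine.Point.add_of_Y_eq rfl ((variableChange_Y_eq_negY_iff h).mpr hy)).symm
  · have hxy' : ¬(C.u ^ 2 * x₁ + C.r = C.u ^ 2 * x₂ + C.r ∧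
        C.u ^ 3 * y₁ + C.u ^ 2 * C.s * x₁ + C.t =
          E.toAffine.negY (C.u ^ 2 * x₂ + C.r) (C.u ^ 3 * y₂ + C.u ^ 2 * C.s * x₂ + C.t)) := by
      rintro ⟨hx, hy⟩
      obtain rfl := (variableChange_X_eq_iff C).mp hx
      exact hxy ⟨rfl, (variableChange_Y_eq_negY_iff h).mp hy⟩
    rw [Affine.Point.add_some hxy]
    refine Eq.trans ?_ (Affine.Point.add_some hxy').symm
    simp only [variableChangeFun, variableChange_slope h hxy h₁.1 h₂.1, variableChange_addX h,
      variableChange_addY h]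

/-- The substitution `variableChangeFun` as a group homomorphism. -/
def variableChangeHom (h : C • E = E') : E'.toAffine.Point →+ E.toAffine.Point where
  toFun := variableChangeFun h
  map_zero' := rfl
  map_add' := variableChangeFun_add h

theorem variableChangeHom_some (h : C • E = E') {x y : K} (hxy : E'.toAffine.Nonsingular x y) :
    variableChangeHom h (.some x y hxy) = .some (C.u ^ 2 * x + C.r)
      (C.u ^ 3 * y + C.u ^ 2 * C.s * x + C.t)
      (Affine.equation_iff_nonsingular.mp (variableChange_equation h hxy.1)) := rfl

theorem isMorphism_variableChangeHom (h : C • E = E') : IsMorphism (variableChangeHom h) := by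
  have hX : ∀ (a : K) (j : Fin 3),
      (MvPolynomial.C a * MvPolynomial.X j : MvPolynomial (Fin 3) K).IsHomogeneous 1 :=
    MvPolynomial.isHomogeneous_C_mul_X
  refine IsMorphism.of_forall_eval_eq_smul (d := 1) (F :=
    ![MvPolynomial.C (C.u ^ 2 : K) * .X 0 + MvPolynomial.C C.r * .X 2,
      MvPolynomial.C (C.u ^ 3 : K) * .X 1 + MvPolynomial.C (C.u ^ 2 * C.s) * .X 0 +
        MvPolynomial.C C.t * .X 2,
      .X 2]) (fun i => ?_) ?_
  · fin_cases i
    · exact (hX _ _).add (hX _ _)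
    · exact ((hX _ _).add (hX _ _)).add (hX _ _)
    · exact MvPolynomial.isHomogeneous_X _ _
  · rintro (_ | ⟨x, y, hxy⟩)
    · refine ⟨C.u ^ 3, pow_ne_zero _ C.u.ne_zero, ?_⟩
      rw [← Affine.Point.zero_def, map_zero]
      ext i
      fin_cases i <;> simp [coords_zero]
    · refine ⟨1, one_ne_zero, ?_⟩
      rw [variableChangeHom_some]
      ext i
      fin_cases i <;> simp [coords_some]

variable [E'.IsElliptic]

theorem variableChangeHom_variableChangeHom {D : VariableChange K} (hD : D = C⁻¹)
    (h : C • E = E') (h' : D • E' = E) (P : E.toAffine.Point) :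
    variableChangeHom h (variableChangeHom h' P) = P := by
  subst hD
  rcases P with _ | ⟨x, y, hxy⟩
  · rfl
  · simp only [variableChangeHom_some, Affine.Point.some.injEq, VariableChange.inv_def,
      Units.val_inv_eq_inv_val]
    exact ⟨by field_simp; ring, by field_simp; ring⟩

/-- The substitution `variableChangeFun` as a group isomorphism. -/
def variableChangeEquiv (h : C • E = E') : E'.toAffine.Point ≃+ E.toAffine.Point :=
  { variableChangeHom h with
    invFun := variableChangeHom (inv_smul_eq_iff.mpr h.symm : C⁻¹ • E' = E)
    left_inv := variableChangeHom_variableChangeHom (inv_inv C).symm (inv_smul_eq_iff.mpr h.symm) h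
    right_inv := variableChangeHom_variableChangeHom rfl h _ }

theorem isMorphism_variableChangeEquiv (h : C • E = E') : IsMorphism (variableChangeEquiv h) :=
  isMorphism_variableChangeHom h

theorem isMorphism_variableChangeEquiv_symm (h : C • E = E') :
    IsMorphism (variableChangeEquiv h).symm :=
  isMorphism_variableChangeHom (inv_smul_eq_iff.mpr h.symm)

theorem IsSupersingular.of_variableChange {p : ℕ} (h : C • E = E') (hE : IsSupersingular p E) :
    IsSupersingular p E' := fun P hP =>
  (variableChangeEquiv h).map_eq_zero_iff.mp (hE _ (by rw [← map_nsmul, hP, map_zero]))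

variable [IsAlgClosed K]

/-- The ring homomorphism from `End E` to `End (C • E)` given by transport of structure along
`variableChangeEquiv`. -/
def endRingVariableChange (h : C • E = E') : endRing E →+* endRing E' where
  toFun φ := ⟨((variableChangeEquiv h).symm.toAddMonoidHom.comp φ.1).comp
      (variableChangeEquiv h).toAddMonoidHom, fun _ =>
    ((isMorphism_variableChangeEquiv_symm h _).comp (φ.2 _)).comp
      (isMorphism_variableChangeEquiv h _)⟩
  map_one' := by
    ext P
    exact (variableChangeEquiv h).symm_apply_apply P
  map_zero' := by
    ext
    exact map_zero (variableChangeEquiv h).symm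
  map_add' φ ψ := by
    ext P
    exact map_add (variableChangeEquiv h).symm _ _
  map_mul' φ ψ := by
    ext P
    exact congrArg (fun Q => (variableChangeEquiv h).symm (φ.1 Q))
      ((variableChangeEquiv h).apply_symm_apply _).symm

theorem endRingVariableChange_injective (h : C • E = E') :
    Function.Injective (endRingVariableChange h) := by
  intro φ ψ hφψ
  refine Subtype.ext (AddMonoidHom.ext fun P => ?_)
  obtain ⟨Q, rfl⟩ := (variableChangeEquiv h).surjective P
  exact (variableChangeEquiv h).symm.injective (DFunLike.congr_fun (congrArg Subtype.val hφψ) Q)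

end VariableChange

section DefiniteNorm

variable {R : Type*} [Ring R]

/-- A multiplicative positive definite quadratic norm on a ring, such as the degree on the
endomorphism ring of an elliptic curve. Being quadratic is expressed by the parallelogram law. -/
structure IsDefiniteNorm (N : R → ℕ) : Prop where
  parallelogram : ∀ x y, N (x + y) + N (x - y) = 2 * N x + 2 * N y
  map_mul : ∀ x y, N (x * y) = N x * N y
  map_one : N 1 = 1
  eq_zero_of_map_eq_zero : ∀ x, N x = 0 → x = 0

namespace IsDefiniteNorm

variable {N : R → ℕ}

theorem map_zero (hN : IsDefiniteNorm N) : N 0 = 0 := by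
  have h := hN.parallelogram 0 0
  rw [add_zero, sub_zero] at h
  omega

theorem map_neg (hN : IsDefiniteNorm N) (x : R) : N (-x) = N x := by
  have h := hN.parallelogram 0 x
  rw [zero_add, zero_sub, hN.map_zero] at h
  omega

theorem map_natCast (hN : IsDefiniteNorm N) (n : ℕ) : N n = n ^ 2 := by
  induction n using Nat.twoStepInduction with
  | zero => simp [hN.map_zero]
  | one => simp [hN.map_one]
  | more n hn hn' =>
    have h := hN.parallelogram ((n + 1 : ℕ) : R) 1
    rw [show ((n + 1 : ℕ) : R) + 1 = (n + 2 : ℕ) by push_cast; rw [add_assoc, one_add_one_eq_two],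
      show ((n + 1 : ℕ) : R) - 1 = n by push_cast; abel, hn, hn', hN.map_one] at h
    linarith

theorem map_intCast (hN : IsDefiniteNorm N) (n : ℤ) : (N n : ℤ) = n ^ 2 := by
  obtain ⟨m, rfl | rfl⟩ := n.eq_nat_or_neg <;> simp [hN.map_neg, hN.map_natCast]

theorem charZero (hN : IsDefiniteNorm N) : CharZero R :=
  charZero_of_inj_zero fun n hn => by
    have h := hN.map_natCast n
    rw [hn, hN.map_zero] at h
    exact pow_eq_zero_iff two_ne_zero |>.mp h.symm

/-- The polar form `N (x + y) - N x - N y`, which is biadditive by the parallelogram law. -/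
def polar (hN : IsDefiniteNorm N) : R →+ R →+ ℤ :=
  have hadd (x y z : R) : (N (x + (y + z)) - N x - N (y + z) : ℤ) =
      N (x + y) - N x - N y + (N (x + z) - N x - N z) := by
    have h₁ := hN.parallelogram (x + y) z
    have h₂ := hN.parallelogram (x + z) y
    have h₃ := hN.parallelogram x (y - z)
    have h₄ := hN.parallelogram y z
    rw [show x + y + z = x + (y + z) by abel, show x + y - z = x + (y - z) by abel] at h₁
    rw [show x + z + y = x + (y + z) by abel, show x + z - y = x - (y - z) by abel] at h₂
    omega
  AddMonoidHom.mk'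
    (fun x => AddMonoidHom.mk' (fun y => (N (x + y) - N x - N y : ℤ)) (hadd x))
    fun x x' => AddMonoidHom.ext fun y => by
      have h := hadd y x x'
      simp only [AddMonoidHom.mk'_apply, AddMonoidHom.add_apply, add_comm _ y] at h ⊢
      linarith

theorem polar_apply (hN : IsDefiniteNorm N) (x y : R) :
    hN.polar x y = N (x + y) - N x - N y := rfl

theorem polar_self (hN : IsDefiniteNorm N) (x : R) : hN.polar x x = 2 * N x := by
  have h := hN.parallelogram x x
  rw [sub_self, hN.map_zero] at h
  rw [polar_apply]
  omega

theorem polar_mul_right (hN : IsDefiniteNorm N) (x y z : R) :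
    hN.polar (x * z) (y * z) = hN.polar x y * N z := by
  simp only [polar_apply, ← add_mul, hN.map_mul]
  push_cast
  ring

-- This is `polar_mul_right` polarized in its last variable.
theorem polar_mul_add_polar_mul (hN : IsDefiniteNorm N) (x y z w : R) :
    hN.polar (x * z) (y * w) + hN.polar (x * w) (y * z) = hN.polar x y * hN.polar z w := by
  have h := hN.polar_mul_right x y (z + w)
  simp only [mul_add, _root_.map_add, AddMonoidHom.add_apply, polar_mul_right] at h
  rw [hN.polar_apply z w]
  linear_combination h

theorem mul_self_sub_trace_add_norm (hN : IsDefiniteNorm N) (x : R) :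
    x * x - hN.polar x 1 • x + N x • (1 : R) = 0 := by
  set v := x * x - hN.polar x 1 • x + N x • (1 : R) with hv
  have orthogonal (w : R) : hN.polar v w = 0 := by
    have h₁ := hN.polar_mul_add_polar_mul x w x 1
    have h₂ := hN.polar_mul_right 1 w x
    rw [mul_one, mul_one] at h₁
    rw [one_mul] at h₂
    rw [hv]
    simp only [_root_.map_add, map_sub, map_zsmul, map_nsmul, AddMonoidHom.add_apply,
      AddMonoidHom.sub_apply, AddMonoidHom.smul_apply, smul_eq_mul]
    rw [nsmul_eq_mul]
    linear_combination h₁ - h₂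
  have hself := hN.polar_self v
  rw [orthogonal] at hself
  exact hN.eq_zero_of_map_eq_zero v (by omega)

theorem eq_zero_of_mul_right (hN : IsDefiniteNorm N) {x y : R} (hy : N y ≠ 0) (h : x * y = 0) :
    x = 0 := by
  have hmul := hN.map_mul x y
  rw [h, hN.map_zero] at hmul
  exact hN.eq_zero_of_map_eq_zero x ((mul_eq_zero.mp hmul.symm).resolve_right hy)

theorem map_one_add_le_four (hN : IsDefiniteNorm N) {x : R} (hx : N x = 1) : N (1 + x) ≤ 4 := by
  have h := hN.parallelogram 1 x
  rw [hN.map_one, hx] at h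
  omega

-- Eliminating `p = ρ * π * π` from the characteristic equation of `π` leaves `(1 + ρ) * π = a` for
-- an integer `a`, so that `p * N (1 + ρ) = a ^ 2`, whereas `N (1 + ρ) ≤ 4`. Hence `ρ = -1`.
theorem mul_self_eq_neg_of_mul_mul_eq (hN : IsDefiniteNorm N) {p : ℕ} (hprime : p.Prime)
    (hp : 3 < p) {π ρ : R} (hπ : N π = p) (hρ : ρ * π * π = p) : π * π = -p := by
  have hρ_norm : N ρ = 1 := by
    have h := congrArg N hρ
    rw [hN.map_mul, hN.map_mul, hN.map_natCast, hπ, mul_assoc, ← pow_two] at h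
    exact Nat.eq_of_mul_eq_mul_right (pow_pos hprime.pos 2) (by rw [h, one_mul])
  obtain ⟨a, ha⟩ : ∃ a : ℤ, (1 + ρ) * π = a := by
    refine ⟨hN.polar π 1, sub_eq_zero.mp (hN.eq_zero_of_mul_right (hπ ▸ hprime.ne_zero) ?_)⟩
    have hchar := hN.mul_self_sub_trace_add_norm π
    rw [hπ, zsmul_eq_mul, nsmul_one, ← hρ] at hchar
    rw [← hchar]
    noncomm_ring
  have hsq : (N (1 + ρ) : ℤ) * p = a ^ 2 := by
    rw [← hN.map_intCast, ← ha, hN.map_mul, hπ, Nat.cast_mul]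
  have hdvd : p ∣ N (1 + ρ) := by
    obtain ⟨b, rfl⟩ : (p : ℤ) ∣ a := Int.Prime.dvd_pow' hprime (Dvd.intro_left _ hsq)
    have hp0 : (p : ℤ) ≠ 0 := by exact_mod_cast hprime.ne_zero
    have hb : (N (1 + ρ) : ℤ) = p * b ^ 2 := mul_right_cancel₀ hp0 (by rw [hsq]; ring)
    exact_mod_cast Dvd.intro _ hb.symm
  have hzero : N (1 + ρ) = 0 := by
    by_contra h0
    have hp4 : p = 4 := by
      have := Nat.le_of_dvd (Nat.pos_of_ne_zero h0) hdvd
      have := hN.map_one_add_le_four hρ_norm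
      omega
    exact absurd hprime (by rw [hp4]; norm_num)
  have hρ_eq : ρ = -1 := (neg_eq_of_add_eq_zero_right (hN.eq_zero_of_map_eq_zero _ hzero)).symm
  rw [← hρ, hρ_eq]
  noncomm_ring

end IsDefiniteNorm

open scoped IsMulCommutative in
theorem exists_zsqrtd_ringHom_injective [CharZero R] {d : ℤ} (hd : ∀ n : ℤ, d ≠ n * n) {α : R}
    (hα : α * α = d) : ∃ ι : ℤ√d →+* R, Function.Injective ι := by
  have : IsMulCommutative (Algebra.adjoin ℤ {α}) := Algebra.isMulCommutative_adjoin ℤ (by simp)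
  let r : {r : Algebra.adjoin ℤ {α} // r * r = d} :=
    ⟨⟨α, Algebra.self_mem_adjoin_singleton ℤ α⟩, Subtype.ext (by simpa using hα)⟩
  exact ⟨(Algebra.adjoin ℤ {α}).val.toRingHom.comp (Zsqrtd.lift r),
    Subtype.val_injective.comp (Zsqrtd.lift_injective r hd)⟩

end DefiniteNorm

open Polynomial

section CoordinateRing

variable {K : Type*} [Field K] {E : WeierstrassCurve K}

/-- The restriction to the curve of the dehomogenization of a form in `X, Y, Z` at `Z = 1`. -/
noncomputable def dehomogenize (E : WeierstrassCurve K) :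
    MvPolynomial (Fin 3) K →ₐ[K] E.toAffine.CoordinateRing :=
  MvPolynomial.aeval ![Affine.CoordinateRing.mk E.toAffine (C X),
    Affine.CoordinateRing.mk E.toAffine X, 1]

theorem evalEval_algebraMap {x y : K} (h : E.toAffine.Equation x y) (f : K[X]) :
    AdjoinRoot.evalEval h (algebraMap K[X] E.toAffine.CoordinateRing f) = f.eval x :=
  (AdjoinRoot.evalEval_mk h (C f)).trans (evalEval_C x y f)

theorem evalEval_mk_X {x y : K} (h : E.toAffine.Equation x y) :
    AdjoinRoot.evalEval h (Affine.CoordinateRing.mk E.toAffine X) = y :=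
  (AdjoinRoot.evalEval_mk h X).trans (evalEval_X x y)

theorem evalEval_dehomogenize {x y : K} (h : E.toAffine.Equation x y) (G : MvPolynomial (Fin 3) K) :
    AdjoinRoot.evalEval h (dehomogenize E G) = MvPolynomial.eval ![x, y, 1] G := by
  suffices (AdjoinRoot.evalEval h).comp (dehomogenize E).toRingHom =
      MvPolynomial.eval ![x, y, 1] from congrArg (· G) this
  refine MvPolynomial.ringHom_ext (fun c => ?_) fun i => ?_
  · simpa [dehomogenize, IsScalarTower.algebraMap_apply K K[X] E.toAffine.CoordinateRing] using
      evalEval_algebraMap h (C c)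
  · fin_cases i
    · simpa [dehomogenize] using evalEval_algebraMap h X
    · simpa [dehomogenize] using evalEval_mk_X h
    · simp [dehomogenize]

theorem evalEval_smul_basis {x y : K} (h : E.toAffine.Equation x y) (a b : K[X]) :
    AdjoinRoot.evalEval h (a • (1 : E.toAffine.CoordinateRing) +
      b • Affine.CoordinateRing.mk E.toAffine X) = a.eval x + b.eval x * y := by
  rw [Algebra.smul_def, Algebra.smul_def, mul_one, map_add, map_mul, evalEval_algebraMap h,
    evalEval_algebraMap h, evalEval_mk_X h]

theorem eval_norm_eq_zero {x y : K} (h : E.toAffine.Equation x y) {r : E.toAffine.CoordinateRing}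
    (hr : AdjoinRoot.evalEval h r = 0) : (Algebra.norm K[X] r).eval x = 0 := by
  obtain ⟨a, b, rfl⟩ := Affine.CoordinateRing.exists_smul_basis_eq r
  rw [evalEval_smul_basis h] at hr
  rw [Affine.CoordinateRing.norm_smul_basis]
  simp only [eval_sub, eval_add, eval_mul, eval_pow, eval_C, eval_X]
  rw [Affine.equation_iff] at h
  linear_combination (a.eval x - b.eval x * (y + E.a₁ * x + E.a₃)) * hr + b.eval x ^ 2 * h

variable [IsAlgClosed K]

theorem exists_nonsingular (E : WeierstrassCurve K) [E.IsElliptic] (x : K) :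
    ∃ y, E.toAffine.Nonsingular x y := by
  obtain ⟨y, hy⟩ := IsAlgClosed.exists_root (E.toAffine.polynomial.map (evalRingHom x)) (by
    rw [Affine.monic_polynomial.degree_map, Affine.degree_polynomial]
    decide)
  refine ⟨y, Affine.equation_iff_nonsingular.mp ?_⟩
  rwa [Affine.Equation, ← map_evalRingHom_eval]

theorem eq_zero_of_evalEval_eq_zero [E.IsElliptic] {d : K[X]} (hd : d ≠ 0)
    {r : E.toAffine.CoordinateRing}
    (hr : ∀ x y (h : E.toAffine.Nonsingular x y), d.eval x ≠ 0 → AdjoinRoot.evalEval h.1 r = 0) :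
    r = 0 := by
  suffices d * Algebra.norm K[X] r = 0 from
    (Algebra.norm_eq_zero_iff_of_basis (Affine.CoordinateRing.basis E.toAffine)).mp
      ((mul_eq_zero.mp this).resolve_left hd)
  refine Polynomial.funext fun x => ?_
  obtain ⟨y, h⟩ := exists_nonsingular E x
  by_cases hx : d.eval x = 0
  · simp [hx]
  · simp [eval_norm_eq_zero h.1 (hr x y h hx)]

end CoordinateRing

section XRep

variable {K : Type*} [Field K] {E : WeierstrassCurve K}

theorem finite_preimage_xRep {s : Set (Fin 2 → K)} (hs : s.Finite) :
    (Affine.Point.xRep ⁻¹' s : Set E.toAffine.Point).Finite := by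
  refine hs.preimage' fun v _ => ?_
  rcases (Affine.Point.xRep ⁻¹' {v} : Set E.toAffine.Point).eq_empty_or_nonempty with h | ⟨P, rfl⟩
  · exact h ▸ Set.finite_empty
  · exact (Set.toFinite {P, -P}).subset fun Q hQ => Affine.Point.eq_or_eq_neg_of_xRep_eq_xRep hQ

theorem eval_Ψ₂Sq {x y : K} (h : E.toAffine.Equation x y) :
    E.Ψ₂Sq.eval x = (y - E.toAffine.negY x y) ^ 2 := by
  rw [Affine.equation_iff] at h
  simp only [Ψ₂Sq, Affine.negY, b₂, b₄, b₆, eval_add, eval_mul, eval_pow, eval_C, eval_X]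
  linear_combination -4 * h

variable [DecidableEq K] [IsAlgClosed K] [E.IsElliptic] {φ : AddMonoid.End E.toAffine.Point}

theorem eq_zero_of_eval_ne_zero {N : K[X]} (hN : N ≠ 0)
    (hφ : ∀ x y (h : E.toAffine.Nonsingular x y), N.eval x ≠ 0 → φ (.some x y h) = 0) : φ = 0 := by
  have hroots : {x | N.eval x = 0}.Finite := N.roots.toFinset.finite_toSet.subset fun x hx => by
    simpa [hN] using hx
  have hsupp : {Q | φ Q ≠ 0}.Finite := by
    refine (finite_preimage_xRep (hroots.image fun x => ![x, 1])).subset ?_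
    rintro (_ | ⟨x, y, h⟩) hQ
    · exact (hQ (map_zero φ)).elim
    · exact ⟨x, by_contra fun hx => hQ (hφ x y h hx), rfl⟩
  choose y hy using exists_nonsingular E
  by_contra hne
  obtain ⟨P, hP⟩ := DFunLike.ne_iff.mp hne
  have hinj : Function.Injective fun x => P + .some x (y x) (hy x) := fun x x' h => by
    simpa using (Affine.Point.some.inj (add_left_cancel h)).1
  refine hroots.infinite_compl ((hsupp.preimage hinj.injOn).subset fun x hx => ?_)
  rw [Set.mem_preimage, Set.mem_ofPred_eq, map_add, hφ x _ (hy x) hx, add_zero]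
  exact hP

theorem dehomogenize_ne_zero (hφ : φ ≠ 0) {F : Fin 3 → MvPolynomial (Fin 3) K} {i : Fin 3}
    (hFi : dehomogenize E (F i) ≠ 0)
    (hF : ∀ Q, ∃ c : K, (fun i => MvPolynomial.eval (coords Q) (F i)) = c • coords (φ Q)) :
    dehomogenize E (F 2) ≠ 0 := by
  refine fun hF2 => hφ (eq_zero_of_eval_ne_zero ((Algebra.norm_ne_zero_iff_of_basis
    (Affine.CoordinateRing.basis E.toAffine)).mpr hFi) ?_)
  refine fun x y h hx => by_contra fun hφx => hx (eval_norm_eq_zero h.1 ?_)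
  obtain ⟨c, hc⟩ := hF (.some x y h)
  rw [evalEval_dehomogenize h.1]
  have hc2 := congrFun hc 2
  have hci := congrFun hc i
  simp only [coords_some, ← evalEval_dehomogenize h.1, hF2, map_zero] at hc2 hci ⊢
  rcases hQ : φ (.some x y h) with _ | ⟨x', y', h'⟩
  · exact (hφx hQ).elim
  · obtain rfl : c = 0 := by simpa [hQ, coords_some] using hc2.symm
    simpa using hci

end XRep

section IsXRep

variable {K : Type*} [Field K] {E : WeierstrassCurve K}

/-- The fraction `f / g` describes the effect of `φ` on `x`-coordinates:
`x (φ P) = f (x P) / g (x P)` in the projective line, at every affine point `P` at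
which `f` and `g` do not both vanish. -/
def IsXRep (φ : E.toAffine.Point → E.toAffine.Point) (f g : K[X]) : Prop :=
  ∀ x y (h : E.toAffine.Nonsingular x y),
    f.eval x * (φ (.some x y h)).xRep 1 = g.eval x * (φ (.some x y h)).xRep 0

theorem dvd_sq_mul_cube_of_equation {R : Type*} [CommRing R] [IsDomain R] {W : WeierstrassCurve R}
    {P : Fin 3 → R} (hP : W.toProjective.Equation P) (hP2 : P 2 ≠ 0) {f g : R}
    (hfg : P 0 * g = f * P 2) : P 2 ∣ P 1 ^ 2 * g ^ 3 := by
  rw [Projective.equation_iff] at hP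
  refine ⟨P 2 * (f ^ 3 + W.a₂ * f ^ 2 * g + W.a₄ * f * g ^ 2 + W.a₆ * g ^ 3) -
    W.a₁ * f * g ^ 2 * P 1 - W.a₃ * g ^ 3 * P 1, mul_left_cancel₀ hP2 ?_⟩
  linear_combination g ^ 3 * hP + ((P 0 * g) ^ 2 + P 0 * g * (f * P 2) + (f * P 2) ^ 2 +
    W.a₂ * g * P 2 * (P 0 * g + f * P 2) + W.a₄ * g ^ 2 * P 2 ^ 2 -
    W.a₁ * g ^ 2 * P 1 * P 2) * hfg

theorem coords_mul_xRep (P : E.toAffine.Point) :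
    coords P 0 * P.xRep 1 = coords P 2 * P.xRep 0 := by
  rcases P with _ | ⟨x, y, h⟩ <;> simp [coords]

theorem mul_coords_eq_of_mul_xRep_eq {a b : K} {P : E.toAffine.Point}
    (h : a * P.xRep 1 = b * P.xRep 0) : coords P 0 * b = a * coords P 2 := by
  rcases P with _ | ⟨x, y, hP⟩
  · simp [coords]
  · simpa [coords, mul_comm x, eq_comm] using h

variable {φ : E.toAffine.Point → E.toAffine.Point} {F : Fin 3 → MvPolynomial (Fin 3) K}
  {d f g : K[X]}

theorem exists_evalEval_dehomogenize_eq_mul_coords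
    (hF : ∀ Q, ∃ c : K, (fun i => MvPolynomial.eval (coords Q) (F i)) = c • coords (φ Q))
    {x y : K} (h : E.toAffine.Nonsingular x y) :
    ∃ c : K, ∀ i, AdjoinRoot.evalEval h.1 (dehomogenize E (F i)) =
      c * coords (φ (.some x y h)) i :=
  (hF (.some x y h)).imp fun _ hc i => (evalEval_dehomogenize h.1 (F i)).trans (congrFun hc i)

variable [IsAlgClosed K] [E.IsElliptic]

theorem dehomogenize_mul_eq_mul_dehomogenize
    (hF : ∀ Q, ∃ c : K, (fun i => MvPolynomial.eval (coords Q) (F i)) = c • coords (φ Q))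
    (hd : d ≠ 0) (hfg : ∀ x y (h : E.toAffine.Nonsingular x y), d.eval x ≠ 0 →
      f.eval x * (φ (.some x y h)).xRep 1 = g.eval x * (φ (.some x y h)).xRep 0) :
    dehomogenize E (F 0) * algebraMap K[X] _ g = algebraMap K[X] _ f * dehomogenize E (F 2) := by
  refine sub_eq_zero.mp (eq_zero_of_evalEval_eq_zero hd fun x y h hx => ?_)
  obtain ⟨c, hc⟩ := exists_evalEval_dehomogenize_eq_mul_coords hF h
  rw [map_sub, map_mul, map_mul, evalEval_algebraMap h.1, evalEval_algebraMap h.1, hc, hc]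
  linear_combination c * mul_coords_eq_of_mul_xRep_eq (hfg x y h hx)

theorem equation_dehomogenize
    (hF : ∀ Q, ∃ c : K, (fun i => MvPolynomial.eval (coords Q) (F i)) = c • coords (φ Q)) :
    (E.map (algebraMap K E.toAffine.CoordinateRing)).toProjective.Equation
      fun i => dehomogenize E (F i) := by
  rw [Projective.equation_iff]
  refine eq_zero_of_evalEval_eq_zero one_ne_zero fun x y h _ => ?_
  obtain ⟨c, hc⟩ := exists_evalEval_dehomogenize_eq_mul_coords hF h
  have hcoords := (Projective.equation_iff _).mp (coords_equation (φ (.some x y h)))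
  have hC (a : K) : AdjoinRoot.evalEval h.1 (algebraMap K E.toAffine.CoordinateRing a) = a := by
    rw [IsScalarTower.algebraMap_apply K K[X], evalEval_algebraMap h.1]
    simp
  simp only [map_sub, map_add, map_mul, map_pow, map_a₁, map_a₂, map_a₃, map_a₄, map_a₆, hC, hc]
  linear_combination c ^ 3 * hcoords

theorem Ψ₂Sq_ne_zero (E : WeierstrassCurve K) [E.IsElliptic] : E.Ψ₂Sq ≠ 0 := by
  obtain ⟨T, hT, hT0, -⟩ := exists_aux_point (0 : E.toAffine.Point)
  rcases T with _ | ⟨x, y, h⟩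
  · exact (hT0 rfl).elim
  · intro h0
    refine hT ?_
    have hx := eval_Ψ₂Sq h.1
    rw [h0, eval_zero, eq_comm, sq_eq_zero_iff, sub_eq_zero] at hx
    simpa [Affine.Point.neg_some] using hx

end IsXRep

section ExistsIsXRep

variable {K : Type*} [Field K] [DecidableEq K] [IsAlgClosed K] {E : WeierstrassCurve K}
  [E.IsElliptic] {φ : AddMonoid.End E.toAffine.Point}

theorem exists_forms_of_isMorphism (hm : IsMorphism φ) (hφ : φ ≠ 0) {x y : K}
    (h : E.toAffine.Nonsingular x y) :
    ∃ F : Fin 3 → MvPolynomial (Fin 3) K,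
      (∀ Q, ∃ c : K, (fun i => MvPolynomial.eval (coords Q) (F i)) = c • coords (φ Q)) ∧
      (∃ i, AdjoinRoot.evalEval h.1 (dehomogenize E (F i)) ≠ 0) ∧ dehomogenize E (F 2) ≠ 0 := by
  obtain ⟨-, F, -, ⟨i, hi⟩, hF⟩ := hm (.some x y h)
  rw [coords_some, ← evalEval_dehomogenize h.1] at hi
  exact ⟨F, hF, ⟨i, hi⟩, dehomogenize_ne_zero hφ (fun h0 => hi (by rw [h0, map_zero])) hF⟩

-- At a point where `f / g` might fail to describe `φ`, the description persists because it can be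
-- substituted into the Weierstrass equation satisfied by a local presentation of `φ`.
theorem IsXRep.of_eval_ne_zero (hm : IsMorphism φ) (hφ : φ ≠ 0) {d f g : K[X]} (hd : d ≠ 0)
    (hfg : ∀ x y (h : E.toAffine.Nonsingular x y), d.eval x ≠ 0 →
      f.eval x * (φ (.some x y h)).xRep 1 = g.eval x * (φ (.some x y h)).xRep 0) :
    IsXRep φ f g := by
  intro x y h
  obtain ⟨F, hF, ⟨i, hi⟩, hF2⟩ := exists_forms_of_isMorphism hm hφ h
  have hcross := dehomogenize_mul_eq_mul_dehomogenize hF hd hfg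
  obtain ⟨c, hc⟩ := exists_evalEval_dehomogenize_eq_mul_coords hF h
  have hc0 : c ≠ 0 := by
    rintro rfl
    exact hi (by rw [hc, zero_mul])
  rcases hP : φ (.some x y h) with _ | ⟨x', y', h'⟩
  · have hdvd := map_dvd (AdjoinRoot.evalEval h.1)
      (dvd_sq_mul_cube_of_equation (equation_dehomogenize hF) hF2 hcross)
    rw [map_mul, map_pow, map_pow, evalEval_algebraMap h.1, hc, hc, hP] at hdvd
    have hg : g.eval x = 0 := by simpa [coords, hc0] using hdvd
    simp [← Affine.Point.zero_def, hg]
  · have hcrossx := congrArg (AdjoinRoot.evalEval h.1) hcross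
    rw [map_mul, map_mul, evalEval_algebraMap h.1, evalEval_algebraMap h.1, hc, hc, hP,
      coords_some] at hcrossx
    rw [Affine.Point.xRep_some]
    simp only [Matrix.cons_val] at hcrossx ⊢
    exact mul_left_cancel₀ hc0 (by linear_combination -hcrossx)

-- Comparing `P` with `-P`, at which `φ` has the same `x`-coordinate, separates the two components
-- of a presentation of `φ` by functions of the form `a + bY`.
theorem exists_isXRep_of_ne_zero (hm : IsMorphism φ) (hφ : φ ≠ 0) :
    ∃ f g : K[X], g ≠ 0 ∧ IsXRep φ f g := by
  obtain ⟨y₀, h₀⟩ := exists_nonsingular E 0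
  obtain ⟨F, hF, -, hF2⟩ := exists_forms_of_isMorphism hm hφ h₀
  obtain ⟨a, b, hab⟩ := Affine.CoordinateRing.exists_smul_basis_eq (dehomogenize E (F 0))
  obtain ⟨a', b', hab'⟩ := Affine.CoordinateRing.exists_smul_basis_eq (dehomogenize E (F 2))
  have hφx x y (h : E.toAffine.Nonsingular x y) : (a.eval x + b.eval x * y) *
      (φ (.some x y h)).xRep 1 = (a'.eval x + b'.eval x * y) * (φ (.some x y h)).xRep 0 := by
    obtain ⟨c, hc⟩ := exists_evalEval_dehomogenize_eq_mul_coords hF h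
    rw [← evalEval_smul_basis h.1, ← evalEval_smul_basis h.1, hab, hab', hc, hc]
    linear_combination c * coords_mul_xRep (φ (.some x y h))
  have hb x y (h : E.toAffine.Nonsingular x y) (hx : E.Ψ₂Sq.eval x ≠ 0) :
      b.eval x * (φ (.some x y h)).xRep 1 = b'.eval x * (φ (.some x y h)).xRep 0 := by
    have hneg := hφx x _ ((Affine.nonsingular_neg x y).mpr h)
    rw [← Affine.Point.neg_some h, map_neg, Affine.Point.xRep_neg] at hneg
    rw [eval_Ψ₂Sq h.1] at hx
    refine mul_left_cancel₀ ((pow_ne_zero_iff two_ne_zero).mp hx) ?_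
    linear_combination hφx x y h - hneg
  by_cases hb' : b' = 0
  · refine ⟨a, a', fun ha' => hF2 (by simp [← hab', ha', hb']), ?_⟩
    refine .of_eval_ne_zero hm hφ (Ψ₂Sq_ne_zero E) fun x y h hx => ?_
    linear_combination hφx x y h - y * hb x y h hx
  · exact ⟨b, b', hb', .of_eval_ne_zero hm hφ (Ψ₂Sq_ne_zero E) hb⟩

theorem exists_isXRep (hm : IsMorphism φ) : ∃ f g : K[X], IsCoprime f g ∧ IsXRep φ f g := by
  by_cases hφ : φ = 0
  · exact ⟨1, 0, isCoprime_one_left, fun x y h => by simp [hφ]⟩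
  obtain ⟨f, g, hg, hfg⟩ := exists_isXRep_of_ne_zero hm hφ
  have hgcd : gcd f g ≠ 0 := gcd_ne_zero_of_right hg
  refine ⟨f / gcd f g, g / gcd f g, isCoprime_div_gcd_div_gcd hg, ?_⟩
  refine .of_eval_ne_zero hm hφ hgcd fun x y h hx => mul_left_cancel₀ hx ?_
  rw [← mul_assoc, ← mul_assoc, ← eval_mul, ← eval_mul,
    EuclideanDomain.mul_div_cancel' hgcd (gcd_dvd_left f g),
    EuclideanDomain.mul_div_cancel' hgcd (gcd_dvd_right f g), hfg x y h]

end ExistsIsXRep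

section BasePointFree

variable {K : Type*} [Field K] {σ ι κ : Type*}

/-- The forms `v i` of degree `m` have no common zero in projective space, so that they define a
morphism between projective spaces. -/
structure IsBasePointFree (m : ℕ) (v : ι → MvPolynomial σ K) : Prop where
  isHomogeneous : ∀ i, (v i).IsHomogeneous m
  exists_eval_ne_zero : ∀ s : σ → K, s ≠ 0 → ∃ i, MvPolynomial.eval s (v i) ≠ 0

theorem eval_smul_of_isHomogeneous {f : MvPolynomial σ K} {n : ℕ} (hf : f.IsHomogeneous n) (c : K)
    (s : σ → K) : MvPolynomial.eval (c • s) f = c ^ n * MvPolynomial.eval s f := by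
  rw [MvPolynomial.eval_eq, MvPolynomial.eval_eq, Finset.mul_sum]
  refine Finset.sum_congr rfl fun d hd => ?_
  simp only [Pi.smul_apply, smul_eq_mul, mul_pow, Finset.prod_mul_distrib,
    Finset.prod_pow_eq_pow_sum, ← hf.degree_eq_sum_deg_support hd]
  ring

theorem eval_eq_eval_of_isHomogeneous_zero {f : MvPolynomial σ K} (hf : f.IsHomogeneous 0)
    (s t : σ → K) : MvPolynomial.eval s f = MvPolynomial.eval t f := by
  rw [MvPolynomial.totalDegree_eq_zero_iff_eq_C.mp (Nat.le_zero.mp hf.totalDegree_le),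
    MvPolynomial.eval_C, MvPolynomial.eval_C]

theorem eval_aeval_mvPolynomial (s : σ → K) (v : ι → MvPolynomial σ K) (f : MvPolynomial ι K) :
    MvPolynomial.eval s (MvPolynomial.aeval v f) =
      MvPolynomial.eval (fun i => MvPolynomial.eval s (v i)) f :=
  MvPolynomial.aeval_bind₁ s v f

theorem IsBasePointFree.comp {m n : ℕ} {v : ι → MvPolynomial σ K} {w : κ → MvPolynomial ι K}
    (hw : IsBasePointFree n w) (hv : IsBasePointFree m v) :
    IsBasePointFree (m * n) fun k => MvPolynomial.aeval v (w k) where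
  isHomogeneous k := (hw.isHomogeneous k).aeval v hv.isHomogeneous
  exists_eval_ne_zero s hs := by
    simp only [eval_aeval_mvPolynomial]
    exact hw.exists_eval_ne_zero _ (Function.ne_iff.mpr (hv.exists_eval_ne_zero s hs))

/-- The coefficients `(v₀w₀, v₀w₁ + v₁w₀, v₁w₁)` of the product of the linear forms
`v₀S + v₁T` and `w₀S + w₁T`; this is the map `ℙ¹ × ℙ¹ → Sym² ℙ¹ = ℙ²`. -/
def symSq {R : Type*} [CommSemiring R] (v w : Fin 2 → R) : Fin 3 → R :=
  ![v 0 * w 0, v 0 * w 1 + v 1 * w 0, v 1 * w 1]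

theorem symSq_smul_smul {R : Type*} [CommSemiring R] (a b : R) (v w : Fin 2 → R) :
    symSq (a • v) (b • w) = (a * b) • symSq v w := by
  ext i
  fin_cases i <;> simp [symSq] <;> ring

theorem map_symSq {R S : Type*} [CommSemiring R] [CommSemiring S] (f : R →+* S)
    (v w : Fin 2 → R) : (fun i => f (symSq v w i)) = symSq (fun i => f (v i)) fun i => f (w i) := by
  ext i
  fin_cases i <;> simp [symSq]

theorem exists_eval_symSq_eq_smul {v w : Fin 2 → MvPolynomial σ K} {s : σ → K}
    {a b : Fin 2 → K}
    (hv : ∃ c : K, (fun i => MvPolynomial.eval s (v i)) = c • a)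
    (hw : ∃ c : K, (fun i => MvPolynomial.eval s (w i)) = c • b) :
    ∃ c : K, (fun i => MvPolynomial.eval s (symSq v w i)) = c • symSq a b := by
  obtain ⟨c, hc⟩ := hv
  obtain ⟨d, hd⟩ := hw
  exact ⟨c * d, by rw [map_symSq (MvPolynomial.eval s), hc, hd, symSq_smul_smul]⟩

theorem symSq_ne_zero {R : Type*} [CommRing R] [IsDomain R] {v w : Fin 2 → R} (hv : v ≠ 0)
    (hw : w ≠ 0) : symSq v w ≠ 0 := by
  intro h
  have h0 : v 0 * w 0 = 0 := congrFun h 0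
  have h1 : v 0 * w 1 + v 1 * w 0 = 0 := congrFun h 1
  have h2 : v 1 * w 1 = 0 := congrFun h 2
  obtain ⟨i, hi⟩ := Function.ne_iff.mp hv
  obtain ⟨j, hj⟩ := Function.ne_iff.mp hw
  fin_cases i <;> fin_cases j <;> simp_all

theorem IsBasePointFree.symSq {m n : ℕ} {v w : Fin 2 → MvPolynomial σ K}
    (hv : IsBasePointFree m v) (hw : IsBasePointFree n w) :
    IsBasePointFree (m + n) (symSq v w) where
  isHomogeneous i := by
    have hmul i j := (hv.isHomogeneous i).mul (hw.isHomogeneous j)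
    fin_cases i
    · exact hmul 0 0
    · exact (hmul 0 1).add (hmul 1 0)
    · exact hmul 1 1
  exists_eval_ne_zero s hs := by
    have heval := map_symSq (MvPolynomial.eval s) v w
    refine Function.ne_iff.mp (heval.trans_ne ?_)
    exact symSq_ne_zero (Function.ne_iff.mpr (hv.exists_eval_ne_zero s hs))
      (Function.ne_iff.mpr (hw.exists_eval_ne_zero s hs))

end BasePointFree

section BinaryForms

variable {K : Type*} [Field K] {ι : Type*} {m n : ℕ}

theorem eval_aeval_X_one (x : K) (f : MvPolynomial (Fin 2) K) :
    (MvPolynomial.aeval ![X, 1] f : K[X]).eval x = MvPolynomial.eval ![x, 1] f := by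
  rw [← coe_aeval_eq_eval, ← AlgHom.comp_apply, MvPolynomial.comp_aeval,
    ← MvPolynomial.aeval_eq_eval]
  congr 2
  ext i
  fin_cases i <;> simp

theorem eval_homogenize_of_eq_zero (f : K[X]) (m : ℕ) {s : Fin 2 → K} (hs : s 1 = 0) :
    MvPolynomial.eval s (f.homogenize m) = f.coeff m * s 0 ^ m := by
  rw [homogenize, map_sum, Finset.sum_eq_single (m, 0)]
  · simp [MvPolynomial.eval_monomial, Finsupp.update_eq_add_single]
  · rintro ⟨i, j⟩ hij hne
    have hj : j ≠ 0 := by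
      rintro rfl
      exact hne (by simpa using hij)
    simp [MvPolynomial.eval_monomial, Finsupp.update_eq_add_single, Finsupp.prod_add_index',
      pow_add, hs, hj]
  · simp

theorem exists_natDegree_le_coeff_ne_zero {f g : K[X]} (h : f ≠ 0 ∨ g ≠ 0) :
    ∃ m, f.natDegree ≤ m ∧ g.natDegree ≤ m ∧ (f.coeff m ≠ 0 ∨ g.coeff m ≠ 0) := by
  wlog hfg : f.natDegree ≤ g.natDegree generalizing f g
  · obtain ⟨m, hg, hf, hm⟩ := this h.symm (le_of_not_ge hfg)
    exact ⟨m, hf, hg, hm.symm⟩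
  refine ⟨g.natDegree, hfg, le_rfl, ?_⟩
  by_cases hg : g = 0
  · have hf : f.natDegree = 0 := by simpa [hg] using hfg
    rw [hg, natDegree_zero, ← hf]
    exact .inl (leadingCoeff_ne_zero.mpr (h.resolve_right (not_not_intro hg)))
  · exact .inr (leadingCoeff_ne_zero.mpr hg)

theorem exists_isBasePointFree_of_isCoprime {f g : K[X]} (h : IsCoprime f g) :
    ∃ (m : ℕ) (F : Fin 2 → MvPolynomial (Fin 2) K), IsBasePointFree m F ∧
      ∀ x, (fun i => MvPolynomial.eval ![x, 1] (F i)) = ![f.eval x, g.eval x] := by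
  obtain ⟨m, hf, hg, hm⟩ := exists_natDegree_le_coeff_ne_zero h.ne_zero_or_ne_zero
  refine ⟨m, ![f.homogenize m, g.homogenize m], ⟨fun i => ?_, fun s hs => ?_⟩, fun x => ?_⟩
  · fin_cases i <;> exact isHomogeneous_homogenize _
  · rw [Fin.exists_fin_two]
    by_cases hs1 : s 1 = 0
    · have hs0 : s 0 ≠ 0 := fun hs0 => hs (funext (Fin.forall_fin_two.mpr ⟨hs0, hs1⟩))
      simpa [eval_homogenize_of_eq_zero, hs1, hs0] using hm
    · simpa [eval_homogenize, hf, hg, hs1] using aeval_ne_zero_of_isCoprime h (s 0 / s 1)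
  · ext i
    fin_cases i <;> simp [eval_homogenize, hf, hg]

theorem isUnit_of_eval_ne_zero [IsAlgClosed K] {f : K[X]} (hf : ∀ x, f.eval x ≠ 0) :
    IsUnit f := by
  by_contra hunit
  obtain ⟨x, hx⟩ := IsAlgClosed.exists_root f (mt isUnit_iff_degree_eq_zero.mpr hunit)
  exact hf x hx

namespace IsBasePointFree

variable [IsAlgClosed K] {v w : ι → MvPolynomial (Fin 2) K}

theorem exists_sum_mul_aeval_eq_one [Fintype ι] (hv : IsBasePointFree m v) :
    ∃ a : ι → K[X], ∑ i, a i * MvPolynomial.aeval ![X, 1] (v i) = 1 := by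
  rw [← Ideal.mem_span_range_iff_exists_fun, ← Ideal.eq_top_iff_one]
  obtain ⟨g, hg⟩ := (IsPrincipalIdealRing.principal
    (Ideal.span (Set.range fun i => (MvPolynomial.aeval ![X, 1] (v i) : K[X])))).principal
  rw [Ideal.submodule_span_eq] at hg
  rw [hg, Ideal.span_singleton_eq_top]
  refine isUnit_of_eval_ne_zero fun x hx => ?_
  obtain ⟨i, hi⟩ := hv.exists_eval_ne_zero ![x, 1] (by simp)
  have hdvd : g ∣ MvPolynomial.aeval ![X, 1] (v i) :=
    Ideal.mem_span_singleton.mp (hg ▸ Ideal.subset_span ⟨i, rfl⟩)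
  rw [← eval_aeval_X_one] at hi
  exact hi (eval_eq_zero_of_dvd_of_eval_eq_zero hdvd hx)

theorem exists_aeval_eq_C_mul [Finite ι] (hv : IsBasePointFree m v) (hw : IsBasePointFree n w)
    {d : K[X]} (hd : d ≠ 0) (h : ∀ x, d.eval x ≠ 0 → ∃ (u : ι → K) (a b : K),
      (fun i => MvPolynomial.eval ![x, 1] (v i)) = a • u ∧
      (fun i => MvPolynomial.eval ![x, 1] (w i)) = b • u) :
    ∃ c ≠ 0, ∀ i, (MvPolynomial.aeval ![X, 1] (w i) : K[X]) =
      C c * MvPolynomial.aeval ![X, 1] (v i) := by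
  have hcross i j : (MvPolynomial.aeval ![X, 1] (v i) : K[X]) * MvPolynomial.aeval ![X, 1] (w j) =
      MvPolynomial.aeval ![X, 1] (v j) * MvPolynomial.aeval ![X, 1] (w i) := by
    refine mul_left_cancel₀ hd (funext fun x => ?_)
    simp only [eval_mul, eval_aeval_X_one]
    by_cases hx : d.eval x = 0
    · rw [hx, zero_mul, zero_mul]
    obtain ⟨u, a, b, ha, hb⟩ := h x hx
    simp only [funext_iff, Pi.smul_apply, smul_eq_mul] at ha hb
    rw [ha, ha, hb, hb]
    ring
  have := Fintype.ofFinite ι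
  obtain ⟨a, ha⟩ := hv.exists_sum_mul_aeval_eq_one
  set r := ∑ i, a i * MvPolynomial.aeval ![X, 1] (w i) with hr
  have hrv j : (MvPolynomial.aeval ![X, 1] (w j) : K[X]) =
      r * MvPolynomial.aeval ![X, 1] (v j) := by
    calc MvPolynomial.aeval ![X, 1] (w j)
        = (∑ i, a i * MvPolynomial.aeval ![X, 1] (v i)) * MvPolynomial.aeval ![X, 1] (w j) := by
          rw [ha, one_mul]
      _ = r * MvPolynomial.aeval ![X, 1] (v j) := by
          rw [hr, Finset.sum_mul, Finset.sum_mul]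
          exact Finset.sum_congr rfl fun i _ => by linear_combination a i * hcross i j
  have hunit : IsUnit r := isUnit_of_eval_ne_zero fun x hx => by
    obtain ⟨i, hi⟩ := hw.exists_eval_ne_zero ![x, 1] (by simp)
    exact hi (by rw [← eval_aeval_X_one, hrv, eval_mul, hx, zero_mul])
  obtain ⟨c, hc, hcr⟩ := Polynomial.isUnit_iff.mp hunit
  exact ⟨c, hc.ne_zero, fun i => hcr ▸ hrv i⟩

-- If `n < m`, then `v i` and `c⁻¹ X₁ ^ (m - n) w i` are forms of the same degree which agree at
-- `X₁ = 1`; hence they are equal, and `(1 : 0)` is a base point of `v`.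
theorem degree_le [Finite ι] (hv : IsBasePointFree m v) (hw : IsBasePointFree n w)
    {d : K[X]} (hd : d ≠ 0) (h : ∀ x, d.eval x ≠ 0 → ∃ (u : ι → K) (a b : K),
      (fun i => MvPolynomial.eval ![x, 1] (v i)) = a • u ∧
      (fun i => MvPolynomial.eval ![x, 1] (w i)) = b • u) : m ≤ n := by
  by_contra! hnm
  obtain ⟨c, hc, hcw⟩ := hv.exists_aeval_eq_C_mul hw hd h
  obtain ⟨i, hi⟩ := hv.exists_eval_ne_zero ![1, 0] (by simp)
  have hvw : MvPolynomial.C c * v i = MvPolynomial.X 1 ^ (m - n) * w i := by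
    refine (homogenize_eq_of_isHomogeneous ((hv.isHomogeneous i).C_mul c) rfl).symm.trans
      (homogenize_eq_of_isHomogeneous (n := m) ?_ ?_)
    · simpa [hnm.le] using
        (MvPolynomial.isHomogeneous_X_pow (1 : Fin 2) (m - n)).mul (hw.isHomogeneous i)
    · simp [hcw]
  have heval := congrArg (MvPolynomial.eval ![1, 0]) hvw
  simp [hc, hi, (Nat.sub_pos_of_lt hnm).ne'] at heval

theorem degree_eq [Finite ι] (hv : IsBasePointFree m v) (hw : IsBasePointFree n w)
    {d : K[X]} (hd : d ≠ 0) (h : ∀ x, d.eval x ≠ 0 → ∃ (u : ι → K) (a b : K),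
      (fun i => MvPolynomial.eval ![x, 1] (v i)) = a • u ∧
      (fun i => MvPolynomial.eval ![x, 1] (w i)) = b • u) : m = n :=
  (hv.degree_le hw hd h).antisymm <| hw.degree_le hv hd fun x hx => by
    obtain ⟨u, a, b, ha, hb⟩ := h x hx
    exact ⟨u, b, a, hb, ha⟩

end IsBasePointFree

end BinaryForms

section AddSubMap

variable {K : Type*} [Field K] {E : WeierstrassCurve K}

theorem isBasePointFree_addSubMap (E : WeierstrassCurve K) [E.IsElliptic] :
    IsBasePointFree 2 E.addSubMap where
  isHomogeneous := E.isHomogeneous_addSubMap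
  exists_eval_ne_zero _ hs := Function.ne_iff.mp (E.addSubMap_ne_zero hs)

theorem eval_addSubMap (a : Fin 3 → K) : (fun i => (E.addSubMap i).eval a) =
    ![a 0 ^ 2 - E.b₄ * a 0 * a 2 - E.b₆ * a 1 * a 2 - E.b₈ * a 2 ^ 2,
      2 * a 1 * a 0 + E.b₂ * a 0 * a 2 + E.b₄ * a 1 * a 2 + E.b₆ * a 2 ^ 2,
      a 1 ^ 2 - 4 * a 0 * a 2] := by
  ext i
  fin_cases i <;> simp [addSubMap]

variable [DecidableEq K]

theorem eval_addSubMap_sym2x_self (P : E.toAffine.Point) :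
    ∃ c : K, (fun i => (E.addSubMap i).eval (P.sym2x P)) = c • (P + P).sym2x 0 := by
  rcases P with _ | ⟨x, y, h⟩
  · refine ⟨1, ?_⟩
    rw [← Affine.Point.zero_def, add_zero, eval_addSubMap]
    simp
  have heq := (Affine.equation_iff ..).mp h.1
  by_cases hy : y = E.toAffine.negY x y
  · refine ⟨x ^ 4 - E.b₄ * x ^ 2 - 2 * E.b₆ * x - E.b₈, ?_⟩
    rw [Affine.Point.add_self_of_Y_eq hy, eval_addSubMap, Affine.Point.sym2x_some_some,
      Affine.Point.sym2x_zero_zero]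
    rw [Affine.negY] at hy
    ext i
    fin_cases i <;> simp only [Fin.zero_eta, Fin.mk_one, Fin.reduceFinMk, Matrix.cons_val,
      Matrix.cons_val_zero, Matrix.cons_val_one, Pi.smul_apply, smul_eq_mul, mul_zero, mul_one,
      one_pow]
    · ring
    · rw [b₂, b₄, b₆]
      linear_combination -4 * heq + (2 * y + E.a₁ * x + E.a₃) * hy
    · ring
  · refine ⟨(y - E.toAffine.negY x y) ^ 2, ?_⟩
    rw [Affine.Point.add_self_of_Y_ne hy, eval_addSubMap, Affine.Point.sym2x_some_some,
      Affine.Point.sym2x_some_zero, Affine.slope_of_Y_ne rfl hy, Affine.addX]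
    have hD0 := sub_ne_zero.mpr hy
    generalize hD : y - E.toAffine.negY x y = D at hD0 ⊢
    rw [Affine.negY] at hD
    ext i
    fin_cases i <;> simp only [Fin.zero_eta, Fin.mk_one, Fin.reduceFinMk, Matrix.cons_val,
      Matrix.cons_val_zero, Matrix.cons_val_one, Pi.smul_apply, smul_eq_mul, mul_one, one_pow]
    · field_simp
      rw [b₄, b₆, b₈]
      linear_combination (8 * x + E.a₁ ^ 2 + 4 * E.a₂) * heq +
        (E.a₁ * (3 * x ^ 2 + 2 * E.a₂ * x + E.a₄ - E.a₁ * y) -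
          (2 * x + E.a₂) * (2 * y + E.a₁ * x + E.a₃ + D)) * hD
    · rw [b₂, b₄, b₆]
      linear_combination -4 * heq + (2 * y + E.a₁ * x + E.a₃ + D) * hD
    · ring

theorem eval_addSubMap_sym2x_of_X_ne {x₁ y₁ x₂ y₂ : K} (h₁ : E.toAffine.Nonsingular x₁ y₁)
    (h₂ : E.toAffine.Nonsingular x₂ y₂) (hx : x₁ ≠ x₂) :
    (fun i => (E.addSubMap i).eval (Affine.Point.sym2x (.some x₁ y₁ h₁) (.some x₂ y₂ h₂))) =
      (x₁ - x₂) ^ 2 • Affine.Point.sym2x (.some x₁ y₁ h₁ + .some x₂ y₂ h₂)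
        (.some x₁ y₁ h₁ - .some x₂ y₂ h₂) := by
  have heq₁ := (Affine.equation_iff ..).mp h₁.1
  have heq₂ := (Affine.equation_iff ..).mp h₂.1
  have hx0 := sub_ne_zero.mpr hx
  rw [sub_eq_add_neg (Affine.Point.some ..), Affine.Point.neg_some, Affine.Point.add_of_X_ne hx,
    Affine.Point.add_of_X_ne hx, eval_addSubMap, Affine.Point.sym2x_some_some,
    Affine.Point.sym2x_some_some, Affine.slope_of_X_ne hx, Affine.slope_of_X_ne hx]
  ext i
  fin_cases i <;> simp [Affine.addX, Affine.negY]
  · field_simp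
    rw [b₄, b₆, b₈]
    linear_combination (-y₁ ^ 2 - E.a₁ * x₁ * y₁ - E.a₃ * y₁ + 2 * y₂ ^ 2 + 2 * E.a₁ * x₂ * y₂ +
      2 * E.a₃ * y₂ + x₁ ^ 3 - 2 * x₁ ^ 2 * x₂ + E.a₂ * x₁ ^ 2 - 2 * x₁ * x₂ ^ 2 -
      E.a₁ ^ 2 * x₁ * x₂ - 4 * E.a₂ * x₁ * x₂ - E.a₁ * E.a₃ * x₁ - E.a₄ * x₁ + 2 * x₂ ^ 3 +
      E.a₁ ^ 2 * x₂ ^ 2 + 2 * E.a₂ * x₂ ^ 2 + E.a₁ * E.a₃ * x₂ - E.a₆) * heq₁ +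
      (-y₂ ^ 2 - E.a₁ * x₂ * y₂ - E.a₃ * y₂ + 4 * x₁ ^ 3 - 2 * x₁ ^ 2 * x₂ + E.a₁ ^ 2 * x₁ ^ 2 +
      4 * E.a₂ * x₁ ^ 2 - 2 * x₁ * x₂ ^ 2 - E.a₁ ^ 2 * x₁ * x₂ - 4 * E.a₂ * x₁ * x₂ +
      E.a₁ * E.a₃ * x₁ + 2 * E.a₄ * x₁ + x₂ ^ 3 + E.a₂ * x₂ ^ 2 - E.a₁ * E.a₃ * x₂ -
      E.a₄ * x₂ + E.a₆) * heq₂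
  · field_simp
    rw [b₂, b₄, b₆]
    linear_combination -2 * heq₁ - 2 * heq₂
  · ring

theorem eval_addSubMap_sym2x (P Q : E.toAffine.Point) :
    ∃ c : K, (fun i => (E.addSubMap i).eval (P.sym2x Q)) = c • (P + Q).sym2x (P - Q) := by
  by_cases hPQ : P.xRep = Q.xRep
  · rcases Affine.Point.eq_or_eq_neg_of_xRep_eq_xRep hPQ with rfl | rfl
    · rw [sub_self]
      exact eval_addSubMap_sym2x_self P
    · rw [← Affine.Point.sym2x_neg_right, neg_add_cancel, Affine.Point.sym2x_comm 0, sub_eq_add_neg]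
      exact eval_addSubMap_sym2x_self (-Q)
  rcases P with _ | ⟨x₁, y₁, h₁⟩ <;> rcases Q with _ | ⟨x₂, y₂, h₂⟩
  · exact (hPQ rfl).elim
  · refine ⟨1, ?_⟩
    rw [← Affine.Point.zero_def, zero_add, zero_sub, Affine.Point.sym2x_neg_right,
      Affine.Point.sym2x_zero_some, Affine.Point.sym2x_some_some, eval_addSubMap]
    simp [sq, two_mul]
  · refine ⟨1, ?_⟩
    rw [← Affine.Point.zero_def, add_zero, sub_zero, Affine.Point.sym2x_some_zero,
      Affine.Point.sym2x_some_some, eval_addSubMap]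
    simp [sq, two_mul]
  · exact ⟨_, eval_addSubMap_sym2x_of_X_ne h₁ h₂ (by simpa using hPQ)⟩

end AddSubMap

section XForms

variable {K : Type*} [Field K] {E : WeierstrassCurve K}

theorem exists_eq_smul_xRep {P : E.toAffine.Point} {v : Fin 2 → K}
    (h : v 0 * P.xRep 1 = v 1 * P.xRep 0) : ∃ c : K, v = c • P.xRep := by
  rcases P with _ | ⟨x, y, hxy⟩
  · refine ⟨v 0, funext (Fin.forall_fin_two.mpr ?_)⟩
    simpa [← Affine.Point.zero_def, eq_comm] using h
  · refine ⟨v 1, funext (Fin.forall_fin_two.mpr ?_)⟩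
    simpa using h

theorem xRep_eq_of_smul_eq_smul {a b : K} {P Q : E.toAffine.Point} {v : Fin 2 → K} (hv : v ≠ 0)
    (hP : v = a • P.xRep) (hQ : v = b • Q.xRep) : P.xRep = Q.xRep := by
  subst hP
  have ha : a ≠ 0 := left_ne_zero_of_smul hv
  have hb : b ≠ 0 := left_ne_zero_of_smul (hQ ▸ hv)
  have h0 := congrFun hQ 0
  have h1 := congrFun hQ 1
  rcases P with _ | ⟨x, y, h⟩ <;> rcases Q with _ | ⟨x', y', h'⟩ <;>
    simp_all [← Affine.Point.zero_def]

/-- The binary forms `F` of degree `m` without common zero describe the effect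
`x (φ P) = F₀ (x P, 1) / F₁ (x P, 1)` of `φ` on the `x`-coordinates of affine points. -/
structure HasXForms (φ : E.toAffine.Point → E.toAffine.Point) (m : ℕ)
    (F : Fin 2 → MvPolynomial (Fin 2) K) : Prop where
  isBasePointFree : IsBasePointFree m F
  exists_eq_smul : ∀ x y (h : E.toAffine.Nonsingular x y),
    ∃ c : K, (fun i => MvPolynomial.eval ![x, 1] (F i)) = c • (φ (.some x y h)).xRep

namespace HasXForms

variable {φ : E.toAffine.Point → E.toAffine.Point} {m : ℕ} {F : Fin 2 → MvPolynomial (Fin 2) K}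

theorem eval_ne_zero (hF : HasXForms φ m F) (x : K) :
    (fun i => MvPolynomial.eval ![x, 1] (F i)) ≠ 0 :=
  Function.ne_iff.mpr (hF.isBasePointFree.exists_eval_ne_zero _ (by simp))

theorem apply_eq_zero_iff (hF : HasXForms φ m F) {x y : K} (h : E.toAffine.Nonsingular x y) :
    φ (.some x y h) = 0 ↔ MvPolynomial.eval ![x, 1] (F 1) = 0 := by
  obtain ⟨c, hc⟩ := hF.exists_eq_smul x y h
  have hc0 : c ≠ 0 := left_ne_zero_of_smul (hc ▸ hF.eval_ne_zero x)
  have hc1 := congrFun hc 1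
  generalize φ (.some x y h) = P at hc1
  rcases P with _ | ⟨x', y', h'⟩
  · simpa [← Affine.Point.zero_def] using hc1
  · simp [hc1, hc0]

end HasXForms

theorem exists_hasXForms [DecidableEq K] [IsAlgClosed K] [E.IsElliptic] (φ : endRing E) :
    ∃ m F, HasXForms φ.1 m F := by
  obtain ⟨f, g, hfg, hφ⟩ := exists_isXRep φ.2
  obtain ⟨m, F, hF, hFfg⟩ := exists_isBasePointFree_of_isCoprime hfg
  refine ⟨m, F, hF, fun x y h => exists_eq_smul_xRep ?_⟩
  simp only [congrFun (hFfg x)]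
  exact hφ x y h

/-- The degree of an endomorphism, as the degree of the self-map of `ℙ¹` which it induces on
`x`-coordinates. -/
noncomputable def deg [DecidableEq K] [IsAlgClosed K] [E.IsElliptic] (φ : endRing E) : ℕ :=
  (exists_hasXForms φ).choose

end XForms

section Degree

variable {K : Type*} [Field K] [DecidableEq K] [IsAlgClosed K] {E : WeierstrassCurve K}
  [E.IsElliptic]

theorem exists_hasXForms_deg (φ : endRing E) : ∃ F, HasXForms φ.1 (deg φ) F :=
  (exists_hasXForms φ).choose_spec

theorem deg_eq_of_eval_ne_zero {φ : endRing E} {m : ℕ} {F : Fin 2 → MvPolynomial (Fin 2) K}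
    (hF : IsBasePointFree m F) {d : K[X]} (hd : d ≠ 0)
    (h : ∀ x y (h : E.toAffine.Nonsingular x y), d.eval x ≠ 0 →
      ∃ c : K, (fun i => MvPolynomial.eval ![x, 1] (F i)) = c • (φ.1 (.some x y h)).xRep) :
    deg φ = m := by
  obtain ⟨G, hG⟩ := exists_hasXForms_deg φ
  refine hG.isBasePointFree.degree_eq hF hd fun x hx => ?_
  obtain ⟨y, hxy⟩ := exists_nonsingular E x
  obtain ⟨a, ha⟩ := hG.exists_eq_smul x y hxy
  obtain ⟨b, hb⟩ := h x y hxy hx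
  exact ⟨_, a, b, ha, hb⟩

theorem HasXForms.deg_eq {φ : endRing E} {m : ℕ} {F : Fin 2 → MvPolynomial (Fin 2) K}
    (hF : HasXForms φ.1 m F) : deg φ = m :=
  deg_eq_of_eval_ne_zero hF.isBasePointFree one_ne_zero fun x y h _ => hF.exists_eq_smul x y h

theorem deg_zero : deg (0 : endRing E) = 0 :=
  HasXForms.deg_eq (F := ![1, 0])
    ⟨⟨Fin.forall_fin_two.mpr
      ⟨MvPolynomial.isHomogeneous_one _ _, MvPolynomial.isHomogeneous_zero ..⟩,
      fun s _ => ⟨0, by simp⟩⟩,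
    fun x y h => ⟨1, by ext i; fin_cases i <;> simp⟩⟩

theorem deg_eq_of_xRep_eq_mul_pow_add {φ : endRing E} {c d : K} (hc : c ≠ 0) {n : ℕ} (hn : n ≠ 0)
    (h : ∀ x y h, (φ.1 (.some x y h)).xRep = ![c * x ^ n + d, 1]) : deg φ = n := by
  refine HasXForms.deg_eq
    (F := ![.C c * .X 0 ^ n + .C d * .X 1 ^ n, (.X 1 : MvPolynomial (Fin 2) K) ^ n])
    ⟨⟨Fin.forall_fin_two.mpr ⟨?_, MvPolynomial.isHomogeneous_X_pow 1 n⟩, fun s hs => ?_⟩,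
      fun x y hxy => ⟨1, ?_⟩⟩
  · exact (MvPolynomial.isHomogeneous_C_mul_X_pow c 0 n).add
      (MvPolynomial.isHomogeneous_C_mul_X_pow d 1 n)
  · rw [Fin.exists_fin_two]
    by_contra! hs0
    have hs1 : s 1 = 0 := by simpa [hn] using hs0.2
    exact hs (funext (Fin.forall_fin_two.mpr ⟨by simpa [hs1, hn, hc] using hs0.1, hs1⟩))
  · rw [h, one_smul]
    ext i
    fin_cases i <;> simp

theorem deg_one : deg (1 : endRing E) = 1 :=
  deg_eq_of_xRep_eq_mul_pow_add (d := 0) one_ne_zero one_ne_zero fun x y h => by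
    change (Affine.Point.some x y h).xRep = _
    rw [Affine.Point.xRep_some, pow_one, one_mul, add_zero]

-- Both sides are the degree of the map sending `x P` to the symmetric functions of
-- `x (φ P + ψ P)` and `x (φ P - ψ P)`.
theorem deg_add_add_deg_sub (φ ψ : endRing E) :
    deg (φ + ψ) + deg (φ - ψ) = 2 * deg φ + 2 * deg ψ := by
  obtain ⟨F, hF⟩ := exists_hasXForms_deg φ
  obtain ⟨G, hG⟩ := exists_hasXForms_deg ψ
  obtain ⟨A, hA⟩ := exists_hasXForms_deg (φ + ψ)
  obtain ⟨B, hB⟩ := exists_hasXForms_deg (φ - ψ)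
  rw [← mul_add, mul_comm 2]
  refine (hA.isBasePointFree.symSq hB.isBasePointFree).degree_eq ((isBasePointFree_addSubMap E).comp
    (hF.isBasePointFree.symSq hG.isBasePointFree)) one_ne_zero fun x _ => ?_
  obtain ⟨y, h⟩ := exists_nonsingular E x
  obtain ⟨a, ha⟩ := exists_eval_symSq_eq_smul (hA.exists_eq_smul x y h) (hB.exists_eq_smul x y h)
  obtain ⟨b, hb⟩ := exists_eval_symSq_eq_smul (hF.exists_eq_smul x y h) (hG.exists_eq_smul x y h)
  obtain ⟨c, hc⟩ := eval_addSubMap_sym2x (φ.1 (.some x y h)) (ψ.1 (.some x y h))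
  refine ⟨_, a, b ^ 2 * c, ha, funext fun i => ?_⟩
  simp only [eval_aeval_mvPolynomial, hb]
  rw [eval_smul_of_isHomogeneous (E.isHomogeneous_addSubMap i), mul_smul]
  exact congrArg (b ^ 2 * ·) (congrFun hc i)

theorem eq_zero_of_deg_eq_zero {φ : endRing E} (hdeg : deg φ = 0) : φ = 0 := by
  obtain ⟨F, hF⟩ := exists_hasXForms_deg φ
  rw [hdeg] at hF
  have hφ {x y x' y'} (h : E.toAffine.Nonsingular x y) (h' : E.toAffine.Nonsingular x' y') :
      φ.1 (.some x y h) = φ.1 (.some x' y' h') ∨ φ.1 (.some x y h) = φ.1 (-.some x' y' h') := by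
    obtain ⟨a, ha⟩ := hF.exists_eq_smul x y h
    obtain ⟨b, hb⟩ := hF.exists_eq_smul x' y' h'
    rw [map_neg]
    refine Affine.Point.eq_or_eq_neg_of_xRep_eq_xRep (xRep_eq_of_smul_eq_smul
      (hF.eval_ne_zero x) ha (.trans (funext fun i => ?_) hb))
    exact eval_eq_eval_of_isHomogeneous_zero (hF.isBasePointFree.isHomogeneous i) _ _
  have hker : ∃ P, P ≠ 0 ∧ φ.1 P = 0 := by
    obtain ⟨y₀, h₀⟩ := exists_nonsingular E 0
    obtain ⟨y₁, h₁⟩ := exists_nonsingular E 1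
    by_contra! hinj
    have hφinj : Function.Injective φ.1 :=
      (injective_iff_map_eq_zero φ.1).mpr fun P hP => by_contra fun hP0 => hinj P hP0 hP
    simpa [Affine.Point.neg_some] using
      (hφ h₀ h₁).imp (fun h => hφinj h) fun h => hφinj h
  obtain ⟨_ | ⟨x₀, y₀, h₀⟩, hP0, hP⟩ := hker
  · exact (hP0 rfl).elim
  refine Subtype.ext (eq_zero_of_eval_ne_zero one_ne_zero fun x y h _ => ?_)
  simpa only [map_neg, hP, neg_zero, or_self] using hφ h h₀

theorem deg_mul (φ ψ : endRing E) : deg (φ * ψ) = deg φ * deg ψ := by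
  obtain ⟨F, hF⟩ := exists_hasXForms_deg φ
  obtain ⟨G, hG⟩ := exists_hasXForms_deg ψ
  by_cases hG1 : (MvPolynomial.aeval ![X, 1] (G 1) : K[X]) = 0
  · have hψ : ψ = 0 := Subtype.ext <| eq_zero_of_eval_ne_zero one_ne_zero fun x y h _ =>
      (hG.apply_eq_zero_iff h).mpr (by rw [← eval_aeval_X_one, hG1, eval_zero])
    rw [hψ, mul_zero, deg_zero, mul_zero]
  rw [mul_comm]
  refine deg_eq_of_eval_ne_zero (hF.isBasePointFree.comp hG.isBasePointFree) hG1
    fun x y h hx => ?_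
  rw [eval_aeval_X_one] at hx
  replace hx := mt (hG.apply_eq_zero_iff h).mp hx
  obtain ⟨b, hb⟩ := hG.exists_eq_smul x y h
  simp only [eval_aeval_mvPolynomial, hb]
  change ∃ c : K, _ = c • (φ.1 (ψ.1 (.some x y h))).xRep
  generalize ψ.1 (.some x y h) = P at hx ⊢
  rcases P with _ | ⟨x', y', h'⟩
  · exact (hx rfl).elim
  · obtain ⟨a, ha⟩ := hF.exists_eq_smul x' y' h'
    refine ⟨b ^ deg φ * a, ?_⟩
    simp only [eval_smul_of_isHomogeneous (hF.isBasePointFree.isHomogeneous _)]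
    rw [mul_smul, ← ha, Affine.Point.xRep_some]
    rfl

theorem isDefiniteNorm_deg : IsDefiniteNorm (deg : endRing E → ℕ) where
  parallelogram := deg_add_add_deg_sub
  map_mul := deg_mul
  map_one := deg_one
  eq_zero_of_map_eq_zero _ := eq_zero_of_deg_eq_zero

end Degree

section TwoTorsion

variable {K : Type*} [Field K]

theorem cubic_eq_of_forall_eval_eq_zero [IsAlgClosed K] {P Q : Cubic K} (ha : Q.a ≠ 0)
    (hPQ : P.a = Q.a) (hQ : Q.discr ≠ 0)
    (h : ∀ x, Q.toPoly.eval x = 0 → P.toPoly.eval x = 0) : P = Q := by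
  classical
  have hcard := Cubic.card_roots_of_discr_ne_zero (φ := RingHom.id K) ha (IsAlgClosed.splits _) hQ
  rw [Cubic.map_roots, Polynomial.map_id] at hcard
  refine (Cubic.toPoly_injective _ _).mp
    (eq_of_degree_sub_lt_of_eval_finset_eq Q.toPoly.roots.toFinset ?_ fun x hx => ?_)
  · have hsub : P.toPoly - Q.toPoly = (⟨0, P.b - Q.b, P.c - Q.c, P.d - Q.d⟩ : Cubic K).toPoly := by
      simp only [Cubic.toPoly, hPQ, C_sub, C_0]
      ring
    rw [hcard, hsub]
    exact (Cubic.degree_of_a_eq_zero rfl).trans_lt (by norm_num)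
  · have hxQ : Q.toPoly.eval x = 0 := (mem_roots'.mp (Multiset.mem_toFinset.mp hx)).2
    rw [h x hxQ, hxQ]

theorem exists_variableChange_of_b_eq {E E' : WeierstrassCurve K} (h2 : (2 : K) ≠ 0)
    (hb₂ : E.b₂ = E'.b₂) (hb₄ : E.b₄ = E'.b₄) (hb₆ : E.b₆ = E'.b₆) :
    ∃ s t : K, (⟨1, 0, s, t⟩ : VariableChange K) • E = E' := by
  have h4 : (4 : K) ≠ 0 := by simpa [show (4 : K) = 2 * 2 by norm_num] using h2
  obtain ⟨s, hs⟩ : ∃ s, E'.a₁ = E.a₁ + 2 * s := ⟨(E'.a₁ - E.a₁) / 2, by field_simp; ring⟩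
  obtain ⟨t, ht⟩ : ∃ t, E'.a₃ = E.a₃ + 2 * t := ⟨(E'.a₃ - E.a₃) / 2, by field_simp; ring⟩
  simp only [b₂, b₄, b₆, hs, ht] at hb₂ hb₄ hb₆
  refine ⟨s, t, WeierstrassCurve.ext ?_ ?_ ?_ ?_ ?_⟩ <;>
    simp only [variableChange_a₁, variableChange_a₂, variableChange_a₃, variableChange_a₄,
      variableChange_a₆, inv_one, Units.val_one]
  · linear_combination -hs
  · exact mul_left_cancel₀ h4 (by linear_combination hb₂)
  · linear_combination -ht
  · exact mul_left_cancel₀ h2 (by linear_combination hb₄)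
  · exact mul_left_cancel₀ h4 (by linear_combination hb₆)

theorem exists_variableChange_of_forall_eval_Ψ₂Sq [IsAlgClosed K] {E E' : WeierstrassCurve K}
    [E'.IsElliptic] (h2 : (2 : K) ≠ 0) (u : Kˣ) (r : K)
    (h : ∀ x, E'.Ψ₂Sq.eval x = 0 → E.Ψ₂Sq.eval (u ^ 2 * x + r) = 0) :
    ∃ C : VariableChange K, C.u = u ∧ C.r = r ∧ C • E = E' := by
  let D : VariableChange K := ⟨u, r, 0, 0⟩
  have h4 : (4 : K) ≠ 0 := by simpa [show (4 : K) = 2 * 2 by norm_num] using h2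
  have heval (x : K) : u ^ 6 * (D • E).Ψ₂Sq.eval x = E.Ψ₂Sq.eval (u ^ 2 * x + r) := by
    simp only [Ψ₂Sq, variableChange_b₂, variableChange_b₄, variableChange_b₆, D,
      Units.val_inv_eq_inv_val, eval_add, eval_mul, eval_C, eval_pow, eval_X]
    field_simp
    ring
  have hcubic : (D • E).twoTorsionPolynomial = E'.twoTorsionPolynomial := by
    refine cubic_eq_of_forall_eval_eq_zero h4 rfl ?_ fun x hx => ?_
    · rw [twoTorsionPolynomial_discr]
      exact mul_ne_zero (by simpa [show (16 : K) = 4 * 4 by norm_num] using h4)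
        E'.isUnit_Δ.ne_zero
    · rw [← Ψ₂Sq_eq] at hx ⊢
      exact (mul_eq_zero_iff_left (pow_ne_zero 6 u.ne_zero)).mp ((heval x).trans (h x hx))
  simp only [twoTorsionPolynomial, Cubic.mk.injEq, mul_right_inj' h2] at hcubic
  obtain ⟨-, hb₂, hb₄, hb₆⟩ := hcubic
  obtain ⟨s, t, hst⟩ := exists_variableChange_of_b_eq h2 hb₂ hb₄ hb₆
  refine ⟨⟨1, 0, s, t⟩ * D, ?_, ?_, by rw [mul_smul, hst]⟩ <;> simp [VariableChange.mul_def, D]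

theorem eval_Ψ₂Sq_eq_zero_iff {E : WeierstrassCurve K} {x y : K} (h : E.toAffine.Nonsingular x y) :
    E.Ψ₂Sq.eval x = 0 ↔ -.some x y h = (.some x y h : E.toAffine.Point) := by
  rw [eval_Ψ₂Sq h.1, pow_eq_zero_iff two_ne_zero, sub_eq_zero, eq_comm, Affine.Point.neg_some,
    Affine.Point.some.injEq, and_iff_right rfl]

end TwoTorsion

section InjectiveEndomorphism

variable {K : Type*} [Field K] [IsAlgClosed K]

-- The only root of `f - f 0` is `0`.
theorem exists_eq_C_mul_X_pow_add_C {f : K[X]} (hf : Function.Injective fun x => f.eval x) :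
    ∃ (c d : K) (n : ℕ), c ≠ 0 ∧ n ≠ 0 ∧ f = C c * X ^ n + C d := by
  have hdeg : f.natDegree ≠ 0 := fun h => by
    rw [natDegree_eq_zero] at h
    obtain ⟨a, rfl⟩ := h
    exact zero_ne_one (hf (by simp : (C a).eval (0 : K) = (C a).eval 1))
  set g := f - C (f.eval 0) with hg
  have hgdeg : g.natDegree = f.natDegree := natDegree_sub_C
  have hg0 : g ≠ 0 := ne_zero_of_natDegree_gt (hgdeg ▸ Nat.pos_of_ne_zero hdeg)
  have hroots : g.roots = Multiset.replicate f.natDegree 0 := by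
    rw [Multiset.eq_replicate, ← hgdeg]
    refine ⟨(IsAlgClosed.splits g).natDegree_eq_card_roots.symm, fun x hx => hf ?_⟩
    simpa [hg, sub_eq_zero] using isRoot_of_mem_roots hx
  refine ⟨g.leadingCoeff, f.eval 0, f.natDegree, leadingCoeff_ne_zero.mpr hg0, hdeg, ?_⟩
  have hprod := (IsAlgClosed.splits g).eq_prod_roots
  rw [hroots, Multiset.map_replicate, Multiset.prod_replicate, C_0, sub_zero] at hprod
  rw [← hprod, hg, sub_add_cancel]

variable {E : WeierstrassCurve K} [DecidableEq K]

theorem injective_of_forall_xRep_eq {φ : AddMonoid.End E.toAffine.Point} [E.IsElliptic]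
    (hφ : Function.Injective φ) {f : K → K}
    (hf : ∀ x y h, (φ (.some x y h)).xRep = ![f x, 1]) : Function.Injective f := by
  intro x₁ x₂ hx
  obtain ⟨y₁, h₁⟩ := exists_nonsingular E x₁
  obtain ⟨y₂, h₂⟩ := exists_nonsingular E x₂
  have hxRep : (φ (.some x₁ y₁ h₁)).xRep = (φ (.some x₂ y₂ h₂)).xRep := by rw [hf, hf, hx]
  rcases Affine.Point.eq_or_eq_neg_of_xRep_eq_xRep hxRep with h | h
  · exact (Affine.Point.some.inj (hφ h)).1
  · rw [← map_neg] at h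
    exact (Affine.Point.some.inj (hφ h)).1

variable [E.IsElliptic] {φ : endRing E}

-- The denominator of the induced map on `x`-coordinates vanishes nowhere, so it is constant.
theorem exists_polynomial_xRep_eq (hφ : Function.Injective φ.1) :
    ∃ f : K[X], ∀ x y h, (φ.1 (.some x y h)).xRep = ![f.eval x, 1] := by
  obtain ⟨f, g, hfg, hrep⟩ := exists_isXRep φ.2
  have hφ0 (x y h) : ∃ x' y' h', φ.1 (.some x y h) = .some x' y' h' := by
    rcases hP : φ.1 (.some x y h) with _ | ⟨x', y', h'⟩
    · exact absurd ((map_eq_zero_iff φ.1 hφ).mp hP) (Affine.Point.some_ne_zero h)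
    · exact ⟨x', y', h', rfl⟩
  have hg (x : K) : g.eval x ≠ 0 := fun hgx => by
    obtain ⟨y, h⟩ := exists_nonsingular E x
    obtain ⟨x', y', h', hP⟩ := hφ0 x y h
    have hfx := hrep x y h
    rw [hP, hgx, Affine.Point.xRep_some] at hfx
    obtain ⟨a, b, hab⟩ := hfg
    simpa [hgx, show f.eval x = 0 by simpa using hfx] using congrArg (eval x) hab
  obtain ⟨e, he, rfl⟩ := isUnit_iff.mp (isUnit_of_eval_ne_zero hg)
  refine ⟨C e⁻¹ * f, fun x y h => ?_⟩
  obtain ⟨x', y', h', hP⟩ := hφ0 x y h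
  have hfx := hrep x y h
  simp only [hP, Affine.Point.xRep_some, eval_C, Matrix.cons_val_zero, Matrix.cons_val_one,
    mul_one] at hfx ⊢
  rw [eval_mul, eval_C, hfx, inv_mul_cancel_left₀ he.ne_zero]

theorem exists_xRep_eq_mul_pow_add (hφ : Function.Injective φ.1) :
    ∃ c d : K, c ≠ 0 ∧ ∀ x y h, (φ.1 (.some x y h)).xRep = ![c * x ^ deg φ + d, 1] := by
  obtain ⟨f, hf⟩ := exists_polynomial_xRep_eq hφ
  obtain ⟨c, d, n, hc, hn, rfl⟩ := exists_eq_C_mul_X_pow_add_C (injective_of_forall_xRep_eq hφ hf)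
  simp only [eval_add, eval_mul, eval_C, eval_pow, eval_X] at hf
  rw [deg_eq_of_xRep_eq_mul_pow_add hc hn hf]
  exact ⟨c, d, hc, hf⟩

-- The map `x ↦ c * x ^ p ^ k + d` preserves the set of `x`-coordinates of points of order two,
-- hence `x ↦ c * x + d` sends those of the Frobenius twist to those of `E`.
theorem exists_variableChange_eq_map_iterateFrobenius {p : ℕ} [Fact p.Prime] [CharP K p]
    (hp : p ≠ 2) (hφ : Function.Injective φ.1) {k : ℕ} (hdeg : deg φ = p ^ k) :
    ∃ C : VariableChange K, C • E = E.map (iterateFrobenius K p k) ∧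
      ∀ x y h, (φ.1 (.some x y h)).xRep = ![C.u ^ 2 * x ^ p ^ k + C.r, 1] := by
  obtain ⟨c, d, hc, hxRep⟩ := exists_xRep_eq_mul_pow_add hφ
  obtain ⟨γ, rfl⟩ := IsAlgClosed.exists_pow_nat_eq c two_pos
  have hγ : γ ≠ 0 := ne_zero_pow two_ne_zero hc
  have hroot (x : K) (hx : E.Ψ₂Sq.eval x = 0) : E.Ψ₂Sq.eval (γ ^ 2 * x ^ p ^ k + d) = 0 := by
    obtain ⟨y, h⟩ := exists_nonsingular E x
    have hneg := congrArg φ.1 ((eval_Ψ₂Sq_eq_zero_iff h).mp hx)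
    have hφx := hxRep x y h
    rw [map_neg] at hneg
    generalize φ.1 (.some x y h) = P at hneg hφx
    rcases P with _ | ⟨x', y', h'⟩
    · simpa [← Affine.Point.zero_def] using congrFun hφx 1
    · have hx' : x' = γ ^ 2 * x ^ deg φ + d := congrFun hφx 0
      rw [← hdeg, ← hx']
      exact (eval_Ψ₂Sq_eq_zero_iff h').mpr hneg
  obtain ⟨C, hu, hr, hC⟩ := exists_variableChange_of_forall_eval_Ψ₂Sq (E := E)
    (E' := E.map (iterateFrobenius K p k)) (Ring.two_ne_zero (ringChar.eq K p ▸ hp))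
    (Units.mk0 γ hγ) d fun x hx => by
      obtain ⟨z, rfl⟩ := (iterateFrobeniusEquiv K p k).surjective x
      rw [iterateFrobeniusEquiv_apply, map_Ψ₂Sq, eval_map_apply, map_eq_zero] at hx
      exact hroot z hx
  exact ⟨C, hC, fun x y h => by rw [hxRep, hdeg, hu, hr, Units.val_mk0]⟩

end InjectiveEndomorphism

section Frobenius

variable {k : Type*} [Field k] [Fintype k] {K : Type*} [Field K] [DecidableEq K] [Algebra k K]

variable (K) in
/-- The Frobenius endomorphism `(x, y) ↦ (x ^ q, y ^ q)` of the points over `K` of a curve over a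
finite field with `q` elements. -/
noncomputable def frobeniusHom (E₀ : WeierstrassCurve k) :
    AddMonoid.End (E₀.baseChange K).toAffine.Point :=
  Affine.Point.map (W' := E₀.toAffine) (FiniteField.frobeniusAlgHom k K)

theorem frobeniusHom_some (E₀ : WeierstrassCurve k) {x y : K}
    (h : (E₀.baseChange K).toAffine.Nonsingular x y) :
    ∃ h', frobeniusHom K E₀ (.some x y h) =
      .some (x ^ Fintype.card k) (y ^ Fintype.card k) h' :=
  ⟨_, Affine.Point.map_some (W' := E₀.toAffine) (FiniteField.frobeniusAlgHom k K) h⟩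

theorem isMorphism_frobeniusHom (E₀ : WeierstrassCurve k) : IsMorphism (frobeniusHom K E₀) := by
  refine IsMorphism.of_forall_eval_eq_smul
    (fun i => MvPolynomial.isHomogeneous_X_pow i (Fintype.card k)) fun Q => ⟨1, one_ne_zero, ?_⟩
  simp only [MvPolynomial.eval_pow, MvPolynomial.eval_X, one_smul]
  rcases Q with _ | ⟨x, y, hxy⟩
  · rw [← Affine.Point.zero_def, map_zero, coords_zero]
    ext i
    fin_cases i <;> simp
  · obtain ⟨h', hQ⟩ := frobeniusHom_some E₀ hxy
    rw [hQ, coords_some, coords_some]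
    ext i
    fin_cases i <;> simp

variable [IsAlgClosed K]

variable (K) in
/-- The Frobenius endomorphism as an element of the endomorphism ring. -/
noncomputable def frobeniusEnd (E₀ : WeierstrassCurve k) [(E₀.baseChange K).IsElliptic] :
    endRing (E₀.baseChange K) :=
  ⟨frobeniusHom K E₀, isMorphism_frobeniusHom E₀⟩

theorem deg_frobeniusEnd (E₀ : WeierstrassCurve k) [(E₀.baseChange K).IsElliptic] :
    deg (frobeniusEnd K E₀) = Fintype.card k :=
  deg_eq_of_xRep_eq_mul_pow_add (d := 0) one_ne_zero Fintype.card_ne_zero fun x y h => by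
    obtain ⟨h', hx⟩ := frobeniusHom_some E₀ h
    change (frobeniusHom K E₀ (.some x y h)).xRep = _
    rw [hx, Affine.Point.xRep_some, one_mul, add_zero]

theorem frobeniusEnd_pow_some (E₀ : WeierstrassCurve k) [(E₀.baseChange K).IsElliptic] (n : ℕ)
    {x y : K} (h : (E₀.baseChange K).toAffine.Nonsingular x y) :
    ∃ h', (frobeniusEnd K E₀ ^ n).1 (.some x y h) =
      .some (x ^ Fintype.card k ^ n) (y ^ Fintype.card k ^ n) h' := by
  induction n with
  | zero => exact ⟨by simpa using h, by simp⟩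
  | succ n ih =>
    obtain ⟨h₁, hn⟩ := ih
    obtain ⟨h₂, hsucc⟩ := frobeniusHom_some E₀ h₁
    simp only [← pow_mul, ← pow_succ] at h₂ hsucc
    refine ⟨h₂, ?_⟩
    rw [← hsucc, ← hn, pow_succ']
    rfl

end Frobenius

section PrimeField

variable {p : ℕ} [Fact p.Prime] {K : Type*} [Field K] [Algebra (ZMod p) K]

theorem map_iterateFrobenius_baseChange [CharP K p] (E₀ : WeierstrassCurve (ZMod p)) (n : ℕ) :
    (E₀.baseChange K).map (iterateFrobenius K p n) = E₀.baseChange K := by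
  rw [baseChange, WeierstrassCurve.map_map]
  exact congrArg E₀.map (Subsingleton.elim _ _)

theorem isDefinedOver_of_j_pow_eq [IsAlgClosed K] {E : WeierstrassCurve K} [E.IsElliptic]
    (h : E.j ^ p = E.j) : IsDefinedOver (ZMod p) E := by
  have : CharP K p := charP_of_injective_algebraMap' (ZMod p) p
  obtain ⟨j, hj⟩ : ∃ j : ZMod p, algebraMap (ZMod p) K j = E.j :=
    (bot_le : ⊥ ≤ (algebraMap (ZMod p) K).fieldRange) ((Subfield.mem_bot_iff_pow_eq_self K p).mpr h)
  have : ((ofJ j).baseChange K).IsElliptic :=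
    inferInstanceAs ((ofJ j).map (algebraMap (ZMod p) K)).IsElliptic
  have hj' : ((ofJ j).baseChange K).j = E.j := by
    rw [← hj, ← congrArg (algebraMap (ZMod p) K) (ofJ_j j)]
    exact map_j _ _
  obtain ⟨C, hC⟩ := exists_variableChange_of_j_eq _ E hj'
  exact ⟨ofJ j, C, inferInstance, hC⟩

end PrimeField

section Supersingular

theorem eq_or_eq_neg_of_forall {A B : Type*} [AddCommGroup A] [AddCommGroup B] {f g : A →+ B}
    (h : ∀ x, f x = g x ∨ f x = -g x) : f = g ∨ f = -g := by
  by_contra! hne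
  obtain ⟨x, hx⟩ := DFunLike.ne_iff.mp hne.1
  obtain ⟨y, hy⟩ := DFunLike.ne_iff.mp hne.2
  have hx' : f x = -g x := (h x).resolve_left hx
  have hy' : f y = g y := (h y).resolve_right hy
  rcases h (x + y) with h' | h'
  · rw [map_add, map_add, hy'] at h'
    exact hx (add_right_cancel h')
  · rw [map_add, map_add, hx', neg_add] at h'
    exact hy (add_left_cancel h')

variable {p : ℕ} {K : Type*} [Field K] [DecidableEq K] [IsAlgClosed K]

theorem natCast_endRing_apply {E : WeierstrassCurve K} [E.IsElliptic] (n : ℕ)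
    (P : E.toAffine.Point) : (n : endRing E).1 P = n • P := by
  rw [show (n : endRing E).1 = (n : AddMonoid.End E.toAffine.Point) from
    map_natCast (endRing E).subtype n, AddMonoid.End.natCast_apply]

theorem IsSupersingular.injective_natCast {E : WeierstrassCurve K} [E.IsElliptic]
    (hE : IsSupersingular p E) : Function.Injective (p : endRing E).1 :=
  (injective_iff_map_eq_zero _).mpr fun P hP => hE P (by rwa [natCast_endRing_apply] at hP)

variable [Fact p.Prime] [Algebra (ZMod p) K]

theorem exists_eq_mul_frobeniusEnd_pow (hp : p ≠ 2) (E₀ : WeierstrassCurve (ZMod p))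
    [(E₀.baseChange K).IsElliptic] {φ : endRing (E₀.baseChange K)}
    (hφ : Function.Injective φ.1) {n : ℕ} (hdeg : deg φ = p ^ n) :
    ∃ ρ, φ = ρ * frobeniusEnd K E₀ ^ n := by
  have : CharP K p := charP_of_injective_algebraMap' (ZMod p) p
  obtain ⟨C, hC, hxRep⟩ := exists_variableChange_eq_map_iterateFrobenius hp hφ hdeg
  rw [map_iterateFrobenius_baseChange] at hC
  let ρ : endRing (E₀.baseChange K) := ⟨variableChangeHom hC, isMorphism_variableChangeHom hC⟩
  have hsign (P) : φ.1 P = (ρ * frobeniusEnd K E₀ ^ n).1 P ∨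
      φ.1 P = -(ρ * frobeniusEnd K E₀ ^ n).1 P := by
    rcases P with _ | ⟨x, y, h⟩
    · exact .inl (by rw [← Affine.Point.zero_def, map_zero, map_zero])
    refine Affine.Point.eq_or_eq_neg_of_xRep_eq_xRep ?_
    obtain ⟨h', hfrob⟩ := frobeniusEnd_pow_some E₀ n h
    change _ = (variableChangeHom hC ((frobeniusEnd K E₀ ^ n).1 (.some x y h))).xRep
    rw [hfrob, hxRep, variableChangeHom_some, Affine.Point.xRep_some, ZMod.card]
  rcases eq_or_eq_neg_of_forall hsign with h | h
  · exact ⟨ρ, Subtype.ext h⟩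
  · exact ⟨-ρ, Subtype.ext (by rw [neg_mul]; exact h)⟩

theorem IsSupersingular.frobeniusEnd_mul_self (hp : 3 < p) {E₀ : WeierstrassCurve (ZMod p)}
    [(E₀.baseChange K).IsElliptic] (hE : IsSupersingular p (E₀.baseChange K)) :
    frobeniusEnd K E₀ * frobeniusEnd K E₀ = -p := by
  obtain ⟨ρ, hρ⟩ := exists_eq_mul_frobeniusEnd_pow (by omega) E₀ hE.injective_natCast
    (isDefiniteNorm_deg.map_natCast p)
  refine isDefiniteNorm_deg.mul_self_eq_neg_of_mul_mul_eq Fact.out hp (ρ := ρ) ?_ ?_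
  · rw [deg_frobeniusEnd, ZMod.card]
  · rw [hρ, pow_two, mul_assoc]

theorem IsSupersingular.isDefinedOver_of_mul_self_eq_neg (hp : p ≠ 2) {E : WeierstrassCurve K}
    [E.IsElliptic] (hE : IsSupersingular p E) {α : endRing E} (hα : α * α = -p) :
    IsDefinedOver (ZMod p) E := by
  have : CharP K p := charP_of_injective_algebraMap' (ZMod p) p
  have hdeg : deg α = p ^ 1 := by
    have h := congrArg deg hα
    rw [deg_mul, isDefiniteNorm_deg.map_neg, isDefiniteNorm_deg.map_natCast, pow_two] at h
    rw [pow_one, Nat.mul_self_inj.mp h]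
  have hinj : Function.Injective α.1 := by
    have h : Function.Injective (α * α).1 := by
      rw [hα]
      exact neg_injective.comp hE.injective_natCast
    exact Function.Injective.of_comp (f := α.1) h
  obtain ⟨C, hC, -⟩ := exists_variableChange_eq_map_iterateFrobenius hp hinj hdeg
  refine isDefinedOver_of_j_pow_eq ?_
  calc E.j ^ p = (E.map (iterateFrobenius K p 1)).j := by
        rw [map_j, iterateFrobenius_one_apply]
    _ = (C • E).j := by simp only [hC]
    _ = E.j := variableChange_j E C

end Supersingular

end EllCurve

theorem mainTheorem4_general (p : ℕ) [Fact p.Prime] (hp : 3 < p)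
    (K : Type*) [Field K] [DecidableEq K] [Algebra (ZMod p) K] [IsAlgClosed K]
    (E : WeierstrassCurve K) [E.IsElliptic] (hE : EllCurve.IsSupersingular p E) :
    EllCurve.IsDefinedOver (ZMod p) E ↔
      ∃ ι : ℤ√(-(p : ℤ)) →+* EllCurve.endRing E, Function.Injective ι := by
  constructor
  · rintro ⟨E₀, u, hE₀, hu⟩
    have : (E₀.baseChange K).IsElliptic :=
      inferInstanceAs (E₀.map (algebraMap (ZMod p) K)).IsElliptic
    have hfrob := (hE.of_variableChange (inv_smul_eq_iff.mpr hu.symm)).frobeniusEnd_mul_self hp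
    have : CharZero (EllCurve.endRing (E₀.baseChange K)) := EllCurve.isDefiniteNorm_deg.charZero
    obtain ⟨ι, hι⟩ := EllCurve.exists_zsqrtd_ringHom_injective (d := -(p : ℤ))
      (fun n => by have := mul_self_nonneg n; omega) (hfrob.trans (by push_cast; rfl))
    exact ⟨(EllCurve.endRingVariableChange hu).comp ι,
      (EllCurve.endRingVariableChange_injective hu).comp hι⟩
  · rintro ⟨ι, -⟩
    refine hE.isDefinedOver_of_mul_self_eq_neg (by omega) (α := ι Zsqrtd.sqrtd) ?_
    rw [← map_mul, Zsqrtd.dmuld, map_intCast, Int.cast_neg, Int.cast_natCast]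

theorem mainTheorem4 (p : ℕ) [Fact p.Prime] (hp : 3 < p)
    (K : Type*) [Field K] [DecidableEq K] [Algebra (ZMod p) K]
    [IsAlgClosed K] [Algebra.IsAlgebraic (ZMod p) K]
    (E : WeierstrassCurve K) [E.IsElliptic] (hE : EllCurve.IsSupersingular p E) :
    EllCurve.IsDefinedOver (ZMod p) E ↔
      ∃ ι : ℤ√(-(p : ℤ)) →+* EllCurve.endRing E, Function.Injective ι :=
  mainTheorem4_general p hp K E hE
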